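/- **Setting.** Let $d\ge 2$ be an integer, $\lambda=\frac d2-1$, $w(t)=(1-t^2)^{\frac{d-3}{2}}$. For $n\ge 0$ let $P_n$ be the generalised Legendre polynomial of dimension $d$ (the Gegenbauer polynomial $C_n^{(\lambda)}$ rescaled so that $P_n(1)=1$), i.e. for $t\in(-1,1)$ $$P_n(t)=\frac{(-1)^n}{2^n}\,\frac{\Gamma(\frac{d-1}{2})}{\Gamma(n+\frac{d-1}{2})}\,(1-t^2)^{-\frac{d-3}{2}}\,\frac{\mathrm d^n}{\mathrm dt^n}(1-t^2)^{n+\frac{d-3}{2}} .$$ Let $N(d,0)=1$, $N(d,n)=\frac{2n+d-2}{n}\binom{n+d-3}{n-1}$ for $n\ge1$, and let $|\mathbb S_{k-1}|$ be the surface area of the unit sphere of $\mathbb R^k$. The Legendre coefficients of $f:(-1,1)\to\mathbb R$ are $$b_n=\frac{N(d,n)\,|\mathbb S_{d-2}|}{|\mathbb S_{d-1}|}\int_{-1}^1 f(t)P_n(t)w(t)\,\mathrm dt .$$ **Assumptions.** Let $f\in C^\infty(-1,1)$, and let $(A_i)_{i\ge0},(B_i)_{i\ge0},(\alpha_i)_{i\ge0},(\beta_i)_{i\ge0}$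 be real sequences with $\frac{1-d}{2}<\alpha_0<\alpha_1<\dots\to\infty$ and $\frac{1-d}{2}<\beta_0<\beta_1<\dots\to\infty$, such that $A_j=0$ implies $A_i=0$ for all $i\ge j$, and likewise for $(B_i)$. Assume that for all integers $k,m\ge 0$ $$f^{(k)}(t)=\sum_{i=0}^m A_i\frac{\mathrm d^k}{\mathrm dt^k}(1+t)^{\alpha_i}+\mathcal O\big((1+t)^{\alpha_{m+1}-k}\big)\quad (t\searrow-1),$$ $$f^{(k)}(t)=\sum_{i=0}^m B_i\frac{\mathrm d^k}{\mathrm dt^k}(1-t)^{\beta_i}+\mathcal O\big((1-t)^{\beta_{m+1}-k}\big)\quad (t\nearrow1).$$ Put $\gamma_\alpha=\min\{\alpha_i:\alpha_i\notin\mathbb N_0,\ A_i\ne0\}$, $\gamma_\beta=\min\{\beta_i:\beta_i\notin\mathbb N_0,\ B_i\neq0\}$ (with $\min\emptyset=\infty$) and $\gamma=\min\{\gamma_\alpha,\gamma_\beta\}$. Write $u_n\sim v_n$ for $\lim u_n/v_n=1$. **Theorem.** The integrals defining $b_n$ converge absolutely, and: 1. If $\gamma=\infty$, then $(b_n)$ decays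 faster than any polynomial: $n^k b_n\to0$ for every $k\in\mathbb N_0$. 2. If $\gamma_\alpha\ne\gamma_\beta$, then there is a constant $c>0$ (depending on $f$ and $d$) with $|b_n|\sim c\,n^{-2\gamma-1}$. 3. If $\gamma_\alpha=\gamma_\beta<\infty$, let $j_\alpha,j_\beta$ be the indices with $\alpha_{j_\alpha}=\gamma=\beta_{j_\beta}$. Then $|b_{n_k}|\in o(n_k^{-2\gamma-1})$ as $k\to\infty$ for every subsequence $(n_k)$ with $(-1)^{n_k}A_{j_\alpha}+B_{j_\beta}=0$ for all $k$. Moreover there is a constant $c>0$ (depending on $f$ and $d$) such that $$|b_{n_k}|\sim c\,\big|(-1)^{n_k}A_{j_\alpha}+B_{j_\beta}\big|\,n_k^{-2\gamma-1}\quad\text{as } k\to\infty$$ for every subsequence $(n_k)$ with $(-1)^{n_k}A_{j_\alpha}+B_{j_\beta}\ne0$ for all $k$. In particular, along the even indices, and along the odd indices, $|b_n|\sim c_\pm n^{-2\gamma-1}$ with a constant $c_\pm>0$ for that parity, whenever $\pm A_{j_\alpha}+B_{j_\beta}\neq 0$. -/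

import Mathlib

open scoped ContDiff Topology Asymptotics

noncomputable section

namespace GenLegendre

/-- The generalised Legendre polynomial of dimension `d` and degree `n`, i.e. the Gegenbauer
polynomial with parameter `lam = d / 2 - 1` rescaled to have the value `1` at `t = 1`, given for
`t` in `(-1, 1)` by Rodrigues' formula. The factors `Γ(2 lam)`, `Γ(n + 2 lam)` and `n!` of the
Gegenbauer normalisation cancel, so `d = 2` is included. The power of `1 - s ^ 2` is only
meaningful on `[-1, 1]`, and only values at `t` in `(-1, 1)` are used. -/
def legendreP (d n : ℕ) (t : ℝ) : ℝ :=
  (-1) ^ n / 2 ^ n * (Real.Gamma (((d : ℝ) - 1) / 2) / Real.Gamma (n + ((d : ℝ) - 1) / 2))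
    * (1 - t ^ 2) ^ (-(((d : ℝ) - 3) / 2))
    * iteratedDeriv n (fun s : ℝ => (1 - s ^ 2) ^ (n + ((d : ℝ) - 3) / 2)) t

/-- The weight function `(1 - t ^ 2) ^ ((d - 3) / 2)` on `(-1, 1)`. -/
def weight (d : ℕ) (t : ℝ) : ℝ := (1 - t ^ 2) ^ (((d : ℝ) - 3) / 2)

/-- `N(d, n)`, for `d ≥ 2`. -/
def harmonicDim (d n : ℕ) : ℝ :=
  if n = 0 then 1 else (2 * (n : ℝ) + d - 2) / n * ((n + d - 3).choose (n - 1) : ℝ)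

/-- The total surface area of the unit sphere of `ℝ ^ k`, with respect to surface measure
(for `k = 1` it is the counting measure of two points, with total mass `2`). -/
def sphereArea (k : ℕ) : ℝ :=
  (MeasureTheory.volume : MeasureTheory.Measure (EuclideanSpace ℝ (Fin k))).toSphere.real Set.univ

/-- The `n`-th Legendre series coefficient of `f` in dimension `d`. The unit sphere of `ℝ ^ d` is
the one of dimension `d - 1`. -/
def legendreCoeff (d : ℕ) (f : ℝ → ℝ) (n : ℕ) : ℝ :=
  harmonicDim d n * sphereArea (d - 1) / sphereArea d
    * ∫ t in Set.Ioo (-1 : ℝ) 1, f t * legendreP d n t * weight d t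

/-- Coefficients `A` and exponents `α` that are admissible for an algebraic endpoint expansion in
dimension `d`: the exponents are larger than `(1 - d) / 2` and increase strictly to infinity, and
once a coefficient vanishes all later ones do. -/
structure IsAdmissible (d : ℕ) (A α : ℕ → ℝ) : Prop where
  lower : (1 - (d : ℝ)) / 2 < α 0
  strictMono : StrictMono α
  tendsto : Filter.Tendsto α Filter.atTop Filter.atTop
  tail_zero : ∀ j, A j = 0 → ∀ i, j ≤ i → A i = 0

/-- A function on `(-1, 1)` (values elsewhere are irrelevant) that is smooth there and has
algebraic asymptotic expansions at both endpoints, which may be differentiated term by term any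
number of times. The case `k = 0` is the expansion of `f` itself. -/
structure HasEndpointExpansions (d : ℕ) (f : ℝ → ℝ) (A α B β : ℕ → ℝ) : Prop where
  smooth : ContDiffOn ℝ ∞ f (Set.Ioo (-1) 1)
  left_admissible : IsAdmissible d A α
  right_admissible : IsAdmissible d B β
  left : ∀ k m : ℕ,
    (fun t : ℝ => iteratedDeriv k f t
        - ∑ i ∈ Finset.range (m + 1), A i * iteratedDeriv k (fun s : ℝ => (1 + s) ^ α i) t)
      =O[𝓝[>] (-1)] fun t : ℝ => (1 + t) ^ (α (m + 1) - k)
  right : ∀ k m : ℕ,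
    (fun t : ℝ => iteratedDeriv k f t
        - ∑ i ∈ Finset.range (m + 1), B i * iteratedDeriv k (fun s : ℝ => (1 - s) ^ β i) t)
      =O[𝓝[<] 1] fun t : ℝ => (1 - t) ^ (β (m + 1) - k)

/-- The smallest exponent with a nonzero coefficient that is not a non-negative integer, and `⊤`
if there is none. (The infimum of a nonempty set is a minimum, since admissible exponents increase
to infinity.) -/
def singularExponent (A α : ℕ → ℝ) : EReal :=
  sInf {x : EReal | ∃ i : ℕ, (∀ m : ℕ, α i ≠ m) ∧ A i ≠ 0 ∧ x = (α i : EReal)}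

end GenLegendre

end

/-! Put `μ = (d - 3) / 2`. By Rodrigues' formula the coefficient is, up to a factor of order `n ^ (d
- 2)`, the integral of `f` against the `n`-th derivative of `(1 - t ^ 2) ^ (n + μ)`, so it can be
studied by integration by parts, with no boundary terms.

For a pure power `(1 - t) ^ a`, moving all `n` derivatives leaves a Beta integral. Its exact value,
`endpointMoment`, contains the rising factorial of `-a` and behaves like `endpointConst μ a * n ^
(-2 * (a + μ + 1))`. The constant carries `1 / Γ(-a)`, so it vanishes exactly for `a` in `ℕ`, where
the moment itself is zero once `n > a`: only singular exponents count. Reflection turns `(1 + t) ^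
a` into the same moment times `(-1) ^ n`, the source of the parity effects.

Subtracting enough terms of both expansions from `f` leaves a function with `K` bounded derivatives.
Moving `K` derivatives onto it and using the weighted `L²` norm of the remaining polynomial bounds
its contribution by `n ^ (-(μ + K))` (`DerivBounded.isBigO_rodriguesIntegral`), negligible for large
`K`. The result is `HasEndpointExpansions.tendsto_legendreCoeff`, from which all three cases follow.
-/

noncomputable section

namespace GenLegendre

open MeasureTheory Set Filter Polynomial

/-! ### Derivatives of `(1 - t ^ 2) ^ a` -/

/-- The polynomial factor of the `k`-th derivative of `(1 - t ^ 2) ^ a`. -/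
def rodriguesPoly (a : ℝ) : ℕ → ℝ[X]
  | 0 => 1
  | k + 1 => (1 - X ^ 2) * derivative (rodriguesPoly a k)
      - C (2 * (a - k)) * X * rodriguesPoly a k

lemma one_sub_sq_pos {t : ℝ} (ht : t ∈ Ioo (-1 : ℝ) 1) : 0 < 1 - t ^ 2 := by
  nlinarith [ht.1, ht.2]

lemma hasDerivAt_one_sub_sq_rpow (a : ℝ) {t : ℝ} (ht : t ∈ Ioo (-1 : ℝ) 1) :
    HasDerivAt (fun s : ℝ => (1 - s ^ 2) ^ a) (-2 * a * t * (1 - t ^ 2) ^ (a - 1)) t := by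
  have h : HasDerivAt (fun s : ℝ => 1 - s ^ 2) (-(2 * t)) t := by
    simpa using (hasDerivAt_pow 2 t).const_sub 1
  convert! h.rpow_const (p := a) (Or.inl (one_sub_sq_pos ht).ne') using 1
  ring

lemma iteratedDeriv_one_sub_sq_rpow (a : ℝ) (k : ℕ) {t : ℝ} (ht : t ∈ Ioo (-1 : ℝ) 1) :
    iteratedDeriv k (fun s : ℝ => (1 - s ^ 2) ^ a) t
      = (rodriguesPoly a k).eval t * (1 - t ^ 2) ^ (a - k) := by
  induction k generalizing t with
  | zero => simp [rodriguesPoly]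
  | succ k ih =>
    rw [iteratedDeriv_succ]
    have hev : iteratedDeriv k (fun s : ℝ => (1 - s ^ 2) ^ a) =ᶠ[𝓝 t]
        fun s => (rodriguesPoly a k).eval s * (1 - s ^ 2) ^ (a - k) := by
      filter_upwards [Ioo_mem_nhds ht.1 ht.2] with s hs using ih hs
    rw [hev.deriv_eq, (((rodriguesPoly a k).hasDerivAt t).fun_mul
      (hasDerivAt_one_sub_sq_rpow (a - k) ht)).deriv]
    have h1 : (1 - t ^ 2) ^ (a - k) = (1 - t ^ 2) * (1 - t ^ 2) ^ (a - k - 1) := by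
      rw [Real.rpow_sub_one (one_sub_sq_pos ht).ne']
      field_simp [(one_sub_sq_pos ht).ne']
    rw [h1, rodriguesPoly]
    push_cast
    rw [show a - (k + 1 : ℝ) = a - k - 1 by ring]
    simp
    ring

lemma contDiffAt_one_sub_sq_rpow (a : ℝ) {t : ℝ} (ht : t ∈ Ioo (-1 : ℝ) 1) {n : WithTop ℕ∞} :
    ContDiffAt ℝ n (fun s : ℝ => (1 - s ^ 2) ^ a) t :=
  ContDiffAt.rpow_const_of_ne (by fun_prop) (one_sub_sq_pos ht).ne'

lemma natDegree_rodriguesPoly_le (a : ℝ) (k : ℕ) : (rodriguesPoly a k).natDegree ≤ k := by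
  induction k with
  | zero => simp [rodriguesPoly]
  | succ k ih =>
    rw [rodriguesPoly]
    refine (natDegree_sub_le _ _).trans (max_le ?_ ?_)
    · rcases eq_or_ne k 0 with rfl | hk
      · simp [rodriguesPoly]
      refine natDegree_mul_le.trans ?_
      have h1 : (1 - X ^ 2 : ℝ[X]).natDegree ≤ 2 := by compute_degree
      have h2 := (natDegree_derivative_le (rodriguesPoly a k))
      omega
    · refine natDegree_mul_le.trans ?_
      have h1 : (C (2 * (a - k)) * X : ℝ[X]).natDegree ≤ 1 := by compute_degree
      omega

/-- The recursion multiplies the top coefficient by `-k - 2 * (a - k) = -(2 * a - k)`. -/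
lemma coeff_rodriguesPoly (a : ℝ) (k : ℕ) :
    (rodriguesPoly a k).coeff k = (-1) ^ k * ∏ j ∈ Finset.range k, (2 * a - j) := by
  induction k with
  | zero => simp [rodriguesPoly]
  | succ k ih =>
    have h1 : ((1 - X ^ 2) * derivative (rodriguesPoly a k)).coeff (k + 1)
        = -(k * (rodriguesPoly a k).coeff k) := by
      rw [sub_mul, one_mul, coeff_sub, coeff_derivative,
        coeff_eq_zero_of_natDegree_lt (n := k + 1 + 1)
          ((natDegree_rodriguesPoly_le a k).trans_lt (by omega))]
      rcases k with _ | k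
      · simp [rodriguesPoly]
      · rw [show k + 1 + 1 = k + 2 by ring, coeff_X_pow_mul, coeff_derivative]
        push_cast; ring
    rw [rodriguesPoly, coeff_sub, h1, mul_assoc, coeff_C_mul, coeff_X_mul, ih,
      Finset.prod_range_succ]
    ring

lemma iterate_derivative_of_natDegree_le {p : ℝ[X]} {n : ℕ} (h : p.natDegree ≤ n) :
    derivative^[n] p = C (n.factorial * p.coeff n) := by
  ext i
  rw [coeff_iterate_derivative, coeff_C]
  split_ifs with hi
  · subst hi
    simp [Nat.descFactorial_self]
  · rw [coeff_eq_zero_of_natDegree_lt (by omega)]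
    simp

/-! ### Power bounds at the endpoints -/

/-- A smooth function on `(-1, 1)` whose derivatives up to order `K` are bounded by
constant multiples of `(1 - t ^ 2) ^ (σ - k)`. -/
structure EndpointBounded (σ : ℝ) (K : ℕ) (g : ℝ → ℝ) : Prop where
  smooth : ContDiffOn ℝ ∞ g (Ioo (-1) 1)
  bound : ∀ k ≤ K, ∃ M, ∀ t ∈ Ioo (-1 : ℝ) 1, |iteratedDeriv k g t| ≤ M * (1 - t ^ 2) ^ (σ - k)

lemma contDiffAt_of_smooth {g : ℝ → ℝ} (hg : ContDiffOn ℝ ∞ g (Ioo (-1) 1)) {t : ℝ}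
    (ht : t ∈ Ioo (-1 : ℝ) 1) : ContDiffAt ℝ ∞ g t :=
  hg.contDiffAt (Ioo_mem_nhds ht.1 ht.2)

lemma hasDerivAt_iteratedDeriv {g : ℝ → ℝ} {t : ℝ} (hg : ContDiffAt ℝ ∞ g t) (k : ℕ) :
    HasDerivAt (iteratedDeriv k g) (iteratedDeriv (k + 1) g t) t := by
  rw [iteratedDeriv_succ]
  have h := (hg.of_le (m := ((k + 1 : ℕ) : WithTop ℕ∞)) (mod_cast le_top)).contDiffWithinAt
    (s := univ)
  have h' := h.differentiableWithinAt_iteratedDerivWithin (m := k)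
    (by exact_mod_cast Nat.lt_succ_self k) (by simp)
  rw [iteratedDerivWithin_univ, differentiableWithinAt_univ] at h'
  exact h'.hasDerivAt

lemma continuousOn_iteratedDeriv {g : ℝ → ℝ} (hg : ContDiffOn ℝ ∞ g (Ioo (-1) 1)) (k : ℕ) :
    ContinuousOn (iteratedDeriv k g) (Ioo (-1) 1) := fun _ ht =>
  (hasDerivAt_iteratedDeriv (contDiffAt_of_smooth hg ht) k).continuousAt.continuousWithinAt

lemma contDiffOn_one_sub_sq_rpow (a : ℝ) :
    ContDiffOn ℝ ∞ (fun s : ℝ => (1 - s ^ 2) ^ a) (Ioo (-1) 1) := fun _ ht =>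
  (contDiffAt_one_sub_sq_rpow a ht).contDiffWithinAt

lemma exists_bound_iteratedDeriv_one_sub_sq_rpow (a : ℝ) (k : ℕ) :
    ∃ M, ∀ t ∈ Ioo (-1 : ℝ) 1,
      |iteratedDeriv k (fun s : ℝ => (1 - s ^ 2) ^ a) t| ≤ M * (1 - t ^ 2) ^ (a - k) := by
  obtain ⟨M, hM⟩ := isCompact_Icc.exists_bound_of_continuousOn (s := Icc (-1 : ℝ) 1)
    (rodriguesPoly a k).continuous.continuousOn
  refine ⟨M, fun t ht => ?_⟩
  rw [iteratedDeriv_one_sub_sq_rpow a k ht, abs_mul,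
    abs_of_pos (Real.rpow_pos_of_pos (one_sub_sq_pos ht) _)]
  exact mul_le_mul_of_nonneg_right (hM t ⟨ht.1.le, ht.2.le⟩)
    (Real.rpow_pos_of_pos (one_sub_sq_pos ht) _).le

/-! ### Beta integrals on `(-1, 1)` -/

lemma ofReal_rpow_mul_rpow {p q x : ℝ} (hx : x ∈ Ioo (0 : ℝ) 1) :
    ((x : ℂ) ^ (((p + 1 : ℝ) : ℂ) - 1) * (1 - (x : ℂ)) ^ (((q + 1 : ℝ) : ℂ) - 1))
      = ((x ^ p * (1 - x) ^ q : ℝ) : ℂ) := by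
  have h1 := Complex.ofReal_cpow hx.1.le p
  have h2 := Complex.ofReal_cpow (sub_pos.2 hx.2).le q
  push_cast at h1 h2 ⊢
  rw [h1, h2]
  simp

lemma integrableOn_Ioo_rpow_mul_rpow {p q : ℝ} (hp : -1 < p) (hq : -1 < q) :
    IntegrableOn (fun x : ℝ => x ^ p * (1 - x) ^ q) (Ioo 0 1) := by
  have h := Complex.betaIntegral_convergent (u := ((p + 1 : ℝ) : ℂ)) (v := ((q + 1 : ℝ) : ℂ))
    (by rw [Complex.ofReal_re]; linarith) (by rw [Complex.ofReal_re]; linarith)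
  rw [intervalIntegrable_iff_integrableOn_Ioo_of_le zero_le_one] at h
  have h' := (h.congr_fun (fun x hx => ofReal_rpow_mul_rpow hx) measurableSet_Ioo).re
  simpa [IntegrableOn] using! h'

lemma integral_Ioo_rpow_mul_rpow {p q : ℝ} (hp : -1 < p) (hq : -1 < q) :
    ∫ x in Ioo (0 : ℝ) 1, x ^ p * (1 - x) ^ q
      = Real.Gamma (p + 1) * Real.Gamma (q + 1) / Real.Gamma (p + q + 2) := by
  have h := ProbabilityTheory.beta_eq_betaIntegralReal (p + 1) (q + 1) (by linarith) (by linarith)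
  rw [Complex.betaIntegral, intervalIntegral.integral_of_le zero_le_one,
    integral_Ioc_eq_integral_Ioo,
    setIntegral_congr_fun measurableSet_Ioo (fun x hx => ofReal_rpow_mul_rpow hx),
    integral_complex_ofReal, Complex.ofReal_re, ProbabilityTheory.beta] at h
  rw [← h, show p + 1 + (q + 1) = p + q + 2 by ring]

lemma image_two_mul_sub_one_Ioo : (fun x : ℝ => 2 * x - 1) '' Ioo 0 1 = Ioo (-1) 1 := by
  ext t
  constructor
  · rintro ⟨x, hx, rfl⟩
    exact ⟨by linarith [hx.1], by linarith [hx.2]⟩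
  · intro ht
    exact ⟨(t + 1) / 2, ⟨by linarith [ht.1], by linarith [ht.2]⟩, by simp; ring⟩

lemma hasDerivWithinAt_two_mul_sub_one (s : Set ℝ) (x : ℝ) :
    HasDerivWithinAt (fun x : ℝ => 2 * x - 1) 2 s x := by
  simpa using (((hasDerivAt_id x).const_mul 2).sub_const 1).hasDerivWithinAt

lemma injOn_two_mul_sub_one (s : Set ℝ) : InjOn (fun x : ℝ => 2 * x - 1) s :=
  fun x _ y _ h => by simpa using h

lemma two_mul_rpow_mul_rpow {p q x : ℝ} (hx : x ∈ Ioo (0 : ℝ) 1) :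
    |(2 : ℝ)| • ((1 + (2 * x - 1)) ^ p * (1 - (2 * x - 1)) ^ q)
      = 2 ^ (p + q + 1) * (x ^ p * (1 - x) ^ q) := by
  rw [show 1 + (2 * x - 1) = 2 * x by ring, show 1 - (2 * x - 1) = 2 * (1 - x) by ring,
    Real.mul_rpow zero_le_two hx.1.le, Real.mul_rpow zero_le_two (sub_pos.2 hx.2).le,
    Real.rpow_add_one two_ne_zero, Real.rpow_add two_pos, abs_two, smul_eq_mul]
  ring

lemma integrableOn_one_add_rpow_mul_one_sub_rpow {p q : ℝ} (hp : -1 < p) (hq : -1 < q) :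
    IntegrableOn (fun t : ℝ => (1 + t) ^ p * (1 - t) ^ q) (Ioo (-1) 1) := by
  rw [← image_two_mul_sub_one_Ioo, integrableOn_image_iff_integrableOn_abs_deriv_smul
    measurableSet_Ioo (fun x _ => hasDerivWithinAt_two_mul_sub_one _ x) (injOn_two_mul_sub_one _)]
  exact IntegrableOn.congr_fun
    (Integrable.const_mul (integrableOn_Ioo_rpow_mul_rpow hp hq) (2 ^ (p + q + 1)))
    (fun x hx => (two_mul_rpow_mul_rpow hx).symm) measurableSet_Ioo

lemma integral_one_add_rpow_mul_one_sub_rpow {p q : ℝ} (hp : -1 < p) (hq : -1 < q) :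
    ∫ t in Ioo (-1 : ℝ) 1, (1 + t) ^ p * (1 - t) ^ q
      = 2 ^ (p + q + 1) * (Real.Gamma (p + 1) * Real.Gamma (q + 1) / Real.Gamma (p + q + 2)) := by
  rw [← image_two_mul_sub_one_Ioo, integral_image_eq_integral_abs_deriv_smul
    measurableSet_Ioo (fun x _ => hasDerivWithinAt_two_mul_sub_one _ x) (injOn_two_mul_sub_one _),
    setIntegral_congr_fun measurableSet_Ioo (fun x hx => two_mul_rpow_mul_rpow hx),
    integral_const_mul, integral_Ioo_rpow_mul_rpow hp hq]

lemma one_sub_sq_rpow {a t : ℝ} (ht : t ∈ Ioo (-1 : ℝ) 1) :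
    (1 - t ^ 2) ^ a = (1 + t) ^ a * (1 - t) ^ a := by
  rw [← Real.mul_rpow (by linarith [ht.1]) (by linarith [ht.2])]
  ring_nf

lemma integrableOn_one_sub_sq_rpow {s : ℝ} (hs : -1 < s) :
    IntegrableOn (fun t : ℝ => (1 - t ^ 2) ^ s) (Ioo (-1) 1) :=
  (integrableOn_one_add_rpow_mul_one_sub_rpow hs hs).congr_fun
    (fun _ ht => (one_sub_sq_rpow ht).symm) measurableSet_Ioo

lemma integrableOn_of_abs_le_one_sub_sq_rpow {F : ℝ → ℝ} {M s : ℝ} (hs : -1 < s)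
    (hF : ContinuousOn F (Ioo (-1) 1)) (h : ∀ t ∈ Ioo (-1 : ℝ) 1, |F t| ≤ M * (1 - t ^ 2) ^ s) :
    IntegrableOn F (Ioo (-1) 1) :=
  ((integrableOn_one_sub_sq_rpow hs).const_mul M).mono'
    (hF.aestronglyMeasurable measurableSet_Ioo)
    ((ae_restrict_iff' measurableSet_Ioo).2 (Eventually.of_forall h))

/-! ### Integration by parts without boundary terms -/

lemma tendsto_zero_of_abs_le_one_sub_sq_rpow {F : ℝ → ℝ} {M s : ℝ} (hs : 0 < s)
    (h : ∀ t ∈ Ioo (-1 : ℝ) 1, |F t| ≤ M * (1 - t ^ 2) ^ s) :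
    Tendsto F (𝓝[>] (-1)) (𝓝 0) ∧ Tendsto F (𝓝[<] 1) (𝓝 0) := by
  have hc : Continuous (fun t : ℝ => M * (1 - t ^ 2) ^ s) :=
    continuous_const.mul ((by fun_prop : Continuous fun t : ℝ => 1 - t ^ 2).rpow_const
      fun _ => Or.inr hs.le)
  constructor
  · have h0 := (hc.tendsto (-1)).mono_left (nhdsWithin_le_nhds (s := Ioi (-1 : ℝ)))
    rw [show M * (1 - (-1 : ℝ) ^ 2) ^ s = 0 by simp [hs.ne']] at h0
    exact squeeze_zero_norm' (eventually_of_mem (Ioo_mem_nhdsGT (by norm_num)) h) h0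
  · have h0 := (hc.tendsto 1).mono_left (nhdsWithin_le_nhds (s := Iio (1 : ℝ)))
    rw [show M * (1 - (1 : ℝ) ^ 2) ^ s = 0 by simp [hs.ne']] at h0
    exact squeeze_zero_norm' (eventually_of_mem (Ioo_mem_nhdsLT (by norm_num)) h) h0

lemma integral_mul_deriv_eq_neg {u v u' v' : ℝ → ℝ}
    (hu : ∀ t ∈ Ioo (-1 : ℝ) 1, HasDerivAt u (u' t) t)
    (hv : ∀ t ∈ Ioo (-1 : ℝ) 1, HasDerivAt v (v' t) t)
    (h1 : IntegrableOn (fun t => u t * v' t) (Ioo (-1) 1))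
    (h2 : IntegrableOn (fun t => u' t * v t) (Ioo (-1) 1))
    (hl : Tendsto (fun t => u t * v t) (𝓝[>] (-1)) (𝓝 0))
    (hr : Tendsto (fun t => u t * v t) (𝓝[<] 1) (𝓝 0)) :
    ∫ t in Ioo (-1 : ℝ) 1, u t * v' t = -∫ t in Ioo (-1 : ℝ) 1, u' t * v t := by
  have h := intervalIntegral.integral_eq_sub_of_hasDerivAt_of_tendsto (a := (-1 : ℝ)) (b := 1)
    (by norm_num) (fun t ht => (hu t ht).mul (hv t ht))
    ((intervalIntegrable_iff_integrableOn_Ioo_of_le (by norm_num)).2 (h2.add h1)) hl hr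
  rw [intervalIntegral.integral_of_le (by norm_num), integral_Ioc_eq_integral_Ioo,
    integral_add h2 h1] at h
  linarith

lemma exists_abs_mul_le {F G : ℝ → ℝ} {p q r : ℝ} (hr : p + q = r)
    (hF : ∃ M, ∀ t ∈ Ioo (-1 : ℝ) 1, |F t| ≤ M * (1 - t ^ 2) ^ p)
    (hG : ∃ M, ∀ t ∈ Ioo (-1 : ℝ) 1, |G t| ≤ M * (1 - t ^ 2) ^ q) :
    ∃ M, ∀ t ∈ Ioo (-1 : ℝ) 1, |F t * G t| ≤ M * (1 - t ^ 2) ^ r := by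
  obtain ⟨M, hM⟩ := hF
  obtain ⟨N, hN⟩ := hG
  refine ⟨M * N, fun t ht => ?_⟩
  rw [abs_mul, ← hr, Real.rpow_add (one_sub_sq_pos ht)]
  calc |F t| * |G t| ≤ (M * (1 - t ^ 2) ^ p) * (N * (1 - t ^ 2) ^ q) :=
        mul_le_mul (hM t ht) (hN t ht) (abs_nonneg _) ((abs_nonneg _).trans (hM t ht))
    _ = _ := by ring

lemma EndpointBounded.integrableOn {σ a : ℝ} {K k m : ℕ} {g : ℝ → ℝ} (hg : EndpointBounded σ K g)
    (hk : k ≤ K) (h : -1 < (σ - k) + (a - m)) :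
    IntegrableOn (fun t => iteratedDeriv k g t
      * iteratedDeriv m (fun s : ℝ => (1 - s ^ 2) ^ a) t) (Ioo (-1) 1) := by
  obtain ⟨M, hM⟩ := exists_abs_mul_le rfl (hg.bound k hk)
    (exists_bound_iteratedDeriv_one_sub_sq_rpow a m)
  exact integrableOn_of_abs_le_one_sub_sq_rpow h ((continuousOn_iteratedDeriv hg.smooth k).mul
    (continuousOn_iteratedDeriv (contDiffOn_one_sub_sq_rpow a) m)) hM

/-- The boundary term is bounded by a multiple of `(1 - t ^ 2)` to the positive power in `h`, hence
vanishes; both integrands have exponent one less, still above `-1`. -/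
lemma EndpointBounded.integral_step {σ a : ℝ} {K k m : ℕ} {g : ℝ → ℝ}
    (hg : EndpointBounded σ K g) (hk : k + 1 ≤ K) (h : 0 < (σ - k) + (a - m)) :
    ∫ t in Ioo (-1 : ℝ) 1, iteratedDeriv k g t
        * iteratedDeriv (m + 1) (fun s : ℝ => (1 - s ^ 2) ^ a) t
      = -∫ t in Ioo (-1 : ℝ) 1, iteratedDeriv (k + 1) g t
        * iteratedDeriv m (fun s : ℝ => (1 - s ^ 2) ^ a) t := by
  obtain ⟨M, hM⟩ := exists_abs_mul_le rfl (hg.bound k (by omega))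
    (exists_bound_iteratedDeriv_one_sub_sq_rpow a m)
  have h0 := tendsto_zero_of_abs_le_one_sub_sq_rpow h hM
  exact integral_mul_deriv_eq_neg
    (fun t ht => hasDerivAt_iteratedDeriv (contDiffAt_of_smooth hg.smooth ht) k)
    (fun t ht => hasDerivAt_iteratedDeriv (contDiffAt_one_sub_sq_rpow a ht) m)
    (hg.integrableOn (by omega) (by push_cast; linarith))
    (hg.integrableOn hk (by push_cast; linarith)) h0.1 h0.2

/-- Integration by parts `K` times without boundary terms. -/
lemma EndpointBounded.integral_mul_iteratedDeriv {σ a : ℝ} {K : ℕ} {g : ℝ → ℝ}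
    (hg : EndpointBounded σ K g) {j : ℕ} (hj : j ≤ K) (m : ℕ) (h : -1 < σ + a - (m + j : ℕ)) :
    ∫ t in Ioo (-1 : ℝ) 1, g t * iteratedDeriv (m + j) (fun s : ℝ => (1 - s ^ 2) ^ a) t
      = (-1) ^ j * ∫ t in Ioo (-1 : ℝ) 1, iteratedDeriv j g t
        * iteratedDeriv m (fun s : ℝ => (1 - s ^ 2) ^ a) t := by
  induction j generalizing m with
  | zero => simp
  | succ j ih =>
    push_cast at h
    have h1 := ih (by omega) (m + 1) (by push_cast; linarith)
    rw [show m + 1 + j = m + (j + 1) by ring] at h1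
    -- The positivity needed here, `0 < (σ - j) + (a - m)`, is `h` shifted by one.
    rw [h1, hg.integral_step hj (by linarith), pow_succ]
    ring

/-! ### Derivatives and bounds for endpoint powers -/

lemma iteratedDeriv_one_add_rpow (α : ℝ) (k : ℕ) (t : ℝ) :
    iteratedDeriv k (fun s : ℝ => (1 + s) ^ α) t
      = (descPochhammer ℝ k).eval α * (1 + t) ^ (α - k) := by
  have h := congrFun (iteratedDeriv_comp_const_add k (fun x : ℝ => x ^ α) 1) t
  rw [h, iteratedDeriv_eq_iterate, Real.iter_deriv_rpow_const]

lemma iteratedDeriv_one_sub_rpow (α : ℝ) (k : ℕ) (t : ℝ) :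
    iteratedDeriv k (fun s : ℝ => (1 - s) ^ α) t
      = (-1) ^ k * ((descPochhammer ℝ k).eval α * (1 - t) ^ (α - k)) := by
  have h := iteratedDeriv_comp_neg k (fun s : ℝ => (1 + s) ^ α) t
  simp only [← sub_eq_add_neg] at h
  rw [h, iteratedDeriv_one_add_rpow, smul_eq_mul, sub_eq_add_neg 1 t]

/-- Used with `x = 1 ± t`, where `x * (2 - x) = 1 - t ^ 2`. The minimum with `0` is needed because a
power singular at one endpoint does not vanish at the other. It makes `min α 0 - k` nonpositive, so
`x * (2 - x) ≤ 2 * x` can be raised to it with reversed inequality. -/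
lemma rpow_sub_le_of_mem_Ioo {α x : ℝ} (hx : x ∈ Ioo (0 : ℝ) 2) (k : ℕ) :
    x ^ (α - k) ≤ 2 ^ (α - min α 0) * 2 ^ (k - min α 0) * (x * (2 - x)) ^ (min α 0 - k) := by
  set σ := min α 0
  have hσ : σ ≤ α := min_le_left _ _
  have hσ' : σ - k ≤ 0 := by linarith [min_le_right α 0, (Nat.cast_nonneg k : (0 : ℝ) ≤ k)]
  have h0 : 0 < x * (2 - x) := mul_pos hx.1 (by linarith [hx.2])
  have h1 : x ^ (α - σ) ≤ 2 ^ (α - σ) :=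
    Real.rpow_le_rpow hx.1.le hx.2.le (by linarith)
  have h2 : x ^ (σ - k) ≤ 2 ^ (k - σ) * (x * (2 - x)) ^ (σ - k) := by
    have h3 : (2 * x) ^ (σ - k) ≤ (x * (2 - x)) ^ (σ - k) :=
      Real.rpow_le_rpow_of_nonpos h0 (by nlinarith [hx.1]) hσ'
    rw [Real.mul_rpow zero_le_two hx.1.le] at h3
    calc x ^ (σ - k) = 2 ^ (k - σ) * (2 ^ (σ - k) * x ^ (σ - k)) := by
          rw [← mul_assoc, ← Real.rpow_add two_pos]; simp
      _ ≤ _ := by gcongr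
  calc x ^ (α - k) = x ^ (α - σ) * x ^ (σ - k) := by rw [← Real.rpow_add hx.1]; ring_nf
    _ ≤ 2 ^ (α - σ) * (2 ^ (k - σ) * (x * (2 - x)) ^ (σ - k)) := by
        gcongr
        exact Real.rpow_nonneg hx.1.le _
    _ = _ := by ring

lemma endpointBounded_one_add_rpow (α : ℝ) (K : ℕ) :
    EndpointBounded (min α 0) K (fun s : ℝ => (1 + s) ^ α) := by
  refine ⟨fun t ht => (ContDiffAt.rpow_const_of_ne (by fun_prop)
    (by linarith [ht.1])).contDiffWithinAt, fun k _ => ⟨|(descPochhammer ℝ k).eval α|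
      * (2 ^ (α - min α 0) * 2 ^ (k - min α 0)), fun t ht => ?_⟩⟩
  have h0 : 0 < 1 + t := by linarith [ht.1]
  rw [iteratedDeriv_one_add_rpow, abs_mul, abs_of_pos (Real.rpow_pos_of_pos h0 _), mul_assoc]
  have h := rpow_sub_le_of_mem_Ioo (α := α) (x := 1 + t) ⟨h0, by linarith [ht.2]⟩ k
  rw [show (1 + t) * (2 - (1 + t)) = 1 - t ^ 2 by ring] at h
  exact mul_le_mul_of_nonneg_left h (abs_nonneg _)

lemma endpointBounded_one_sub_rpow (α : ℝ) (K : ℕ) :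
    EndpointBounded (min α 0) K (fun s : ℝ => (1 - s) ^ α) := by
  refine ⟨fun t ht => (ContDiffAt.rpow_const_of_ne (by fun_prop)
    (by linarith [ht.2])).contDiffWithinAt, fun k _ => ⟨|(descPochhammer ℝ k).eval α|
      * (2 ^ (α - min α 0) * 2 ^ (k - min α 0)), fun t ht => ?_⟩⟩
  have h0 : 0 < 1 - t := by linarith [ht.2]
  rw [iteratedDeriv_one_sub_rpow, abs_mul, abs_mul, abs_of_pos (Real.rpow_pos_of_pos h0 _),
    abs_pow, abs_neg, abs_one, one_pow, one_mul, mul_assoc]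
  have h := rpow_sub_le_of_mem_Ioo (α := α) (x := 1 - t) ⟨h0, by linarith [ht.1]⟩ k
  rw [show (1 - t) * (2 - (1 - t)) = 1 - t ^ 2 by ring] at h
  exact mul_le_mul_of_nonneg_left h (abs_nonneg _)

/-! ### Exact moments of endpoint powers -/

/-- The normalising factor in the Rodrigues formula for the weight `(1 - t ^ 2) ^ μ`. -/
def rodriguesFactor (μ : ℝ) (n : ℕ) : ℝ :=
  (-1) ^ n / 2 ^ n * (Real.Gamma (μ + 1) / Real.Gamma (n + μ + 1))

/-- The integral of `g` against the `n`-th generalised Legendre polynomial and the weight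
`(1 - t ^ 2) ^ μ`. -/
def rodriguesIntegral (μ : ℝ) (g : ℝ → ℝ) (n : ℕ) : ℝ :=
  rodriguesFactor μ n * ∫ t in Ioo (-1 : ℝ) 1,
    g t * iteratedDeriv n (fun s : ℝ => (1 - s ^ 2) ^ (n + μ)) t

/-- The value of `rodriguesIntegral μ` at `(1 - t) ^ a`. -/
def endpointMoment (μ a : ℝ) (n : ℕ) : ℝ :=
  2 ^ (a + 2 * μ + 1) * Real.Gamma (μ + 1) * Real.Gamma (a + μ + 1)
    * (∏ j ∈ Finset.range n, (-a + j)) / Real.Gamma (n + (a + 2 * μ + 2))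

lemma neg_one_pow_mul_descPochhammer_eval (a : ℝ) (n : ℕ) :
    (-1) ^ n * (descPochhammer ℝ n).eval a = ∏ j ∈ Finset.range n, (-a + j) := by
  rw [descPochhammer_eval_eq_prod_range, ← Finset.card_range n, ← Finset.prod_const,
    Finset.card_range, ← Finset.prod_mul_distrib]
  exact Finset.prod_congr rfl fun j _ => by ring

/-- All `n` derivatives move onto `(1 - t) ^ a`, leaving a Beta integral. The normalisation, the
integrations by parts and the derivatives each give a sign `(-1) ^ n`; the one that survives turns
the falling factorial of `a` into the rising factorial of `-a`. -/
lemma rodriguesIntegral_one_sub_rpow {μ a : ℝ} (hμ : -1 < μ) (ha : -1 < a + μ) (n : ℕ) :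
    rodriguesIntegral μ (fun t => (1 - t) ^ a) n = endpointMoment μ a n := by
  have hσ : -1 < min a 0 + μ := by rcases min_choice a 0 with h | h <;> rw [h] <;> linarith
  have h := (endpointBounded_one_sub_rpow a n).integral_mul_iteratedDeriv (a := n + μ) le_rfl 0
    (by push_cast; linarith)
  have hn : (0 : ℝ) ≤ n := n.cast_nonneg
  have hG : Real.Gamma (n + μ + 1) ≠ 0 := (Real.Gamma_pos_of_pos (by linarith)).ne'
  have hI : ∫ t in Ioo (-1 : ℝ) 1, iteratedDeriv n (fun s : ℝ => (1 - s) ^ a) t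
        * iteratedDeriv 0 (fun s : ℝ => (1 - s ^ 2) ^ (n + μ)) t
      = (-1) ^ n * (descPochhammer ℝ n).eval a
        * ∫ t in Ioo (-1 : ℝ) 1, (1 + t) ^ (n + μ) * (1 - t) ^ (a + μ) := by
    rw [← integral_const_mul]
    refine setIntegral_congr_fun measurableSet_Ioo fun t ht => ?_
    have h1 : (1 - t) ^ (a + μ) = (1 - t) ^ (a - n) * (1 - t) ^ (n + μ) := by
      rw [← Real.rpow_add (by linarith [ht.2])]
      ring_nf
    simp only [iteratedDeriv_one_sub_rpow, iteratedDeriv_zero, one_sub_sq_rpow ht, h1]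
    ring
  rw [zero_add] at h
  rw [rodriguesIntegral, rodriguesFactor, h, hI,
    integral_one_add_rpow_mul_one_sub_rpow (by linarith) ha, endpointMoment,
    ← neg_one_pow_mul_descPochhammer_eval,
    show (n + μ + (a + μ) + 1 : ℝ) = a + 2 * μ + 1 + n by ring, Real.rpow_add two_pos,
    Real.rpow_natCast, show (n + μ + (a + μ) + 2 : ℝ) = n + (a + 2 * μ + 2) by ring]
  have h1 : ((-1 : ℝ) ^ n) ^ 2 = 1 := by rw [← pow_mul, mul_comm, pow_mul]; simp
  generalize Real.Gamma (n + (a + 2 * μ + 2)) = G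
  field_simp
  linear_combination (Real.Gamma (μ + 1) * (descPochhammer ℝ n).eval a * Real.Gamma (a + μ + 1)
    * G⁻¹) * h1

lemma iteratedDeriv_one_sub_sq_rpow_neg (a : ℝ) (n : ℕ) (t : ℝ) :
    iteratedDeriv n (fun s : ℝ => (1 - s ^ 2) ^ a) (-t)
      = (-1) ^ n * iteratedDeriv n (fun s : ℝ => (1 - s ^ 2) ^ a) t := by
  have h := iteratedDeriv_comp_neg n (fun s : ℝ => (1 - s ^ 2) ^ a) (-t)
  simpa using h

/-- The `n`-th derivative of an even function has parity `(-1) ^ n`; this reduces the left endpoint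
to the right one. -/
lemma rodriguesIntegral_comp_neg (μ : ℝ) (g : ℝ → ℝ) (n : ℕ) :
    rodriguesIntegral μ (fun t => g (-t)) n = (-1) ^ n * rodriguesIntegral μ g n := by
  have h := intervalIntegral.integral_comp_neg (a := -1) (b := 1)
    (fun t => g t * iteratedDeriv n (fun s : ℝ => (1 - s ^ 2) ^ (n + μ)) t)
  rw [neg_neg, intervalIntegral.integral_of_le (by norm_num), integral_Ioc_eq_integral_Ioo,
    intervalIntegral.integral_of_le (by norm_num), integral_Ioc_eq_integral_Ioo] at h
  simp only [iteratedDeriv_one_sub_sq_rpow_neg, mul_left_comm _ ((-1 : ℝ) ^ n)] at h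
  rw [integral_const_mul] at h
  rw [rodriguesIntegral, rodriguesIntegral, ← h]
  have h1 : ((-1 : ℝ) ^ n) * (-1) ^ n = 1 := by rw [← mul_pow]; simp
  linear_combination -(rodriguesFactor μ n * ∫ t in Ioo (-1 : ℝ) 1,
    g (-t) * iteratedDeriv n (fun s : ℝ => (1 - s ^ 2) ^ (n + μ)) t) * h1

lemma rodriguesIntegral_one_add_rpow {μ a : ℝ} (hμ : -1 < μ) (ha : -1 < a + μ) (n : ℕ) :
    rodriguesIntegral μ (fun t => (1 + t) ^ a) n = (-1) ^ n * endpointMoment μ a n := by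
  rw [← rodriguesIntegral_one_sub_rpow hμ ha, ← rodriguesIntegral_comp_neg]
  simp

/-! ### Asymptotics of the moments -/

lemma tendsto_natCast_div_add (s : ℝ) :
    Tendsto (fun n : ℕ => (n : ℝ) / (n + s)) atTop (𝓝 1) := by
  have h := (tendsto_const_nhds (x := (1 : ℝ))).sub ((tendsto_const_nhds (x := s)).div_atTop
    (tendsto_atTop_add_const_right _ s (tendsto_natCast_atTop_atTop (R := ℝ))))
  rw [sub_zero] at h
  refine h.congr' ?_
  filter_upwards [(tendsto_atTop_add_const_right _ s
    (tendsto_natCast_atTop_atTop (R := ℝ))).eventually_gt_atTop 0] with n hn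
  field_simp [hn.ne']
  ring

/-- The rising factorial of `s` divided by `n ^ (s - 1) * n !` tends to `1 / Γ(s)`, for all
real `s`. -/
lemma tendsto_prod_range_add_div (s : ℝ) :
    Tendsto (fun n : ℕ => (∏ j ∈ Finset.range n, (s + j)) / ((n : ℝ) ^ (s - 1) * n.factorial))
      atTop (𝓝 (Real.Gamma s)⁻¹) := by
  by_cases hs : ∃ m : ℕ, s = -m
  · obtain ⟨m, rfl⟩ := hs
    -- At a pole `Real.Gamma` takes the value `0`, so the claimed limit is `0`, in agreement with
    -- the zero factor `j = m` of the product.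
    rw [(Real.Gamma_eq_zero_iff _).2 ⟨m, rfl⟩, inv_zero]
    refine tendsto_const_nhds.congr' ?_
    filter_upwards [eventually_gt_atTop m] with n hn
    rw [Finset.prod_eq_zero (Finset.mem_range.2 hn) (by simp), zero_div]
  · push Not at hs
    -- `Real.GammaSeq` has the extra factor `s + n`; multiplying by `n / (n + s)` removes it and
    -- lowers the power of `n` by one.
    have h := ((Real.GammaSeq_tendsto_Gamma s).inv₀ (Real.Gamma_ne_zero hs)).mul
      (tendsto_natCast_div_add s)
    rw [mul_one] at h
    refine h.congr' ?_
    filter_upwards [eventually_gt_atTop 0, (tendsto_atTop_add_const_right _ s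
      (tendsto_natCast_atTop_atTop (R := ℝ))).eventually_gt_atTop 0] with n hn hn'
    have hn0 : (0 : ℝ) < n := Nat.cast_pos.2 hn
    rw [Real.GammaSeq, Finset.prod_range_succ, Real.rpow_sub_one hn0.ne']
    have : (n.factorial : ℝ) ≠ 0 := by positivity
    have h2 : s + n ≠ 0 := by linarith
    have h3 := (Real.rpow_pos_of_pos hn0 s).ne'
    rw [add_comm (n : ℝ) s]
    field_simp

lemma Gamma_natCast_add {b : ℝ} (hb : 0 < b) (n : ℕ) :
    Real.Gamma (n + b) = Real.Gamma b * ∏ j ∈ Finset.range n, (b + j) := by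
  induction n with
  | zero => simp
  | succ n ih =>
    rw [Finset.prod_range_succ, ← mul_assoc, ← ih, Nat.cast_succ,
      show (n + 1 + b : ℝ) = n + b + 1 by ring, Real.Gamma_add_one (by positivity)]
    ring

lemma tendsto_Gamma_div {b : ℝ} (hb : 0 < b) :
    Tendsto (fun n : ℕ => Real.Gamma (n + b) / ((n : ℝ) ^ (b - 1) * n.factorial))
      atTop (𝓝 1) := by
  have h := (tendsto_prod_range_add_div b).const_mul (Real.Gamma b)
  rw [mul_inv_cancel₀ (Real.Gamma_pos_of_pos hb).ne'] at h
  refine h.congr fun n => ?_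
  rw [Gamma_natCast_add hb, mul_div_assoc]

/-- The limit of `endpointMoment μ a n * n ^ (2 * (a + μ + 1))`. -/
def endpointConst (μ a : ℝ) : ℝ :=
  2 ^ (a + 2 * μ + 1) * Real.Gamma (μ + 1) * Real.Gamma (a + μ + 1) * (Real.Gamma (-a))⁻¹

/-- The rising factorial of `-a` is compared with `n ^ (-a - 1) * n !`, the Gamma denominator with
`n ^ (a + 2 * μ + 1) * n !`; the factorials cancel. -/
lemma tendsto_endpointMoment {μ a : ℝ} (hμ : -1 < μ) (ha : -1 < a + μ) :
    Tendsto (fun n : ℕ => endpointMoment μ a n * (n : ℝ) ^ (2 * (a + μ + 1))) atTop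
      (𝓝 (endpointConst μ a)) := by
  have h := ((tendsto_prod_range_add_div (-a)).const_mul
    (2 ^ (a + 2 * μ + 1) * Real.Gamma (μ + 1) * Real.Gamma (a + μ + 1))).mul
    ((tendsto_Gamma_div (b := a + 2 * μ + 2) (by linarith)).inv₀ one_ne_zero)
  rw [inv_one, mul_one] at h
  refine h.congr' ?_
  filter_upwards [eventually_gt_atTop 0] with n hn
  have hn0 : (0 : ℝ) < n := Nat.cast_pos.2 hn
  rw [endpointMoment, show 2 * (a + μ + 1) = (a + 2 * μ + 2 - 1) - (-a - 1) by ring,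
    Real.rpow_sub hn0 (a + 2 * μ + 2 - 1) (-a - 1)]
  have h1 : (n.factorial : ℝ) ≠ 0 := by positivity
  have h2 := (Real.rpow_pos_of_pos hn0 (-a - 1)).ne'
  have h3 := (Real.rpow_pos_of_pos hn0 (a + 2 * μ + 2 - 1)).ne'
  have h4 : Real.Gamma (n + (a + 2 * μ + 2)) ≠ 0 :=
    (Real.Gamma_pos_of_pos (by linarith)).ne'
  generalize (n : ℝ) ^ (-a - 1) = u at *
  generalize (n : ℝ) ^ (a + 2 * μ + 2 - 1) = v at *
  field_simp

/-- The factor `j = m` is zero. This is the orthogonality of the polynomials to lower degrees, and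
it removes integer exponents from the asymptotics. -/
lemma endpointMoment_natCast {μ : ℝ} {m n : ℕ} (h : m < n) : endpointMoment μ m n = 0 := by
  rw [endpointMoment, Finset.prod_eq_zero (Finset.mem_range.2 h) (by simp)]
  simp

lemma endpointConst_ne_zero {μ a : ℝ} (hμ : -1 < μ) (ha : -1 < a + μ) (h : ∀ m : ℕ, a ≠ m) :
    endpointConst μ a ≠ 0 := by
  have h1 := Real.Gamma_ne_zero (s := -a) fun m hm => h m (by linarith)
  have h2 := Real.Gamma_pos_of_pos (s := μ + 1) (by linarith)
  have h3 := Real.Gamma_pos_of_pos (s := a + μ + 1) (by linarith)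
  rw [endpointConst]
  positivity

/-! ### Decay of the coefficients of functions with bounded derivatives -/

/-- Smooth functions on `(-1, 1)` with bounded derivatives up to order `K`. -/
structure DerivBounded (K : ℕ) (g : ℝ → ℝ) : Prop where
  smooth : ContDiffOn ℝ ∞ g (Ioo (-1) 1)
  bound : ∀ k ≤ K, ∃ M, ∀ t ∈ Ioo (-1 : ℝ) 1, |iteratedDeriv k g t| ≤ M

lemma DerivBounded.endpointBounded {K : ℕ} {g : ℝ → ℝ} (hg : DerivBounded K g) :
    EndpointBounded 0 K g := by
  refine ⟨hg.smooth, fun k hk => ?_⟩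
  obtain ⟨M, hM⟩ := hg.bound k hk
  refine ⟨M, fun t ht => (hM t ht).trans (le_mul_of_one_le_right
    ((abs_nonneg _).trans (hM t ht)) (Real.one_le_rpow_of_pos_of_le_one_of_nonpos
      (one_sub_sq_pos ht) (by nlinarith) (by simp)))⟩

lemma iteratedDeriv_eval (p : ℝ[X]) (k : ℕ) :
    iteratedDeriv k (fun t => p.eval t) = fun t => (derivative^[k] p).eval t := by
  induction k with
  | zero => simp
  | succ k ih =>
    ext t
    rw [iteratedDeriv_succ, ih, Polynomial.deriv, Function.iterate_succ_apply']

lemma derivBounded_eval (p : ℝ[X]) (K : ℕ) : DerivBounded K (fun t => p.eval t) := by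
  refine ⟨(by simpa using p.contDiff_aeval (𝕜 := ℝ) ∞ : ContDiff ℝ ∞ fun t => p.eval t).contDiffOn,
    fun k _ => ?_⟩
  obtain ⟨M, hM⟩ := isCompact_Icc.exists_bound_of_continuousOn (s := Icc (-1 : ℝ) 1)
    (derivative^[k] p).continuous.continuousOn
  exact ⟨M, fun t ht => by rw [iteratedDeriv_eval]; exact hM t ⟨ht.1.le, ht.2.le⟩⟩

lemma eval_rodriguesPoly_mul (ν : ℝ) (m : ℕ) {t : ℝ} (ht : t ∈ Ioo (-1 : ℝ) 1) :
    iteratedDeriv m (fun s : ℝ => (1 - s ^ 2) ^ (m + ν)) t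
      = (rodriguesPoly (m + ν) m).eval t * (1 - t ^ 2) ^ ν := by
  rw [iteratedDeriv_one_sub_sq_rpow _ _ ht, add_sub_cancel_left]

/-- One factor, together with the weight, is an `m`-th derivative; moving it onto the other factor
leaves `m !` times the top coefficient. -/
lemma integral_rodriguesPoly_sq {ν : ℝ} (hν : -1 < ν) (m : ℕ) :
    ∫ t in Ioo (-1 : ℝ) 1, (rodriguesPoly (m + ν) m).eval t ^ 2 * (1 - t ^ 2) ^ ν
      = m.factorial * (∏ j ∈ Finset.range m, (2 * (m + ν) - j))
        * ∫ t in Ioo (-1 : ℝ) 1, (1 - t ^ 2) ^ (m + ν) := by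
  set p := rodriguesPoly (m + ν) m with hp
  have h := (derivBounded_eval p m).endpointBounded.integral_mul_iteratedDeriv (a := m + ν)
    le_rfl 0 (by push_cast; linarith)
  rw [zero_add, iteratedDeriv_eval, iteratedDeriv_zero,
    iterate_derivative_of_natDegree_le (natDegree_rodriguesPoly_le _ _), coeff_rodriguesPoly] at h
  simp only [eval_C] at h
  rw [integral_const_mul] at h
  rw [setIntegral_congr_fun measurableSet_Ioo (g := fun t => p.eval t
    * iteratedDeriv m (fun s : ℝ => (1 - s ^ 2) ^ (m + ν)) t), h]
  · have h1 : ((-1 : ℝ) ^ m) * (-1) ^ m = 1 := by rw [← mul_pow]; simp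
    linear_combination (m.factorial * (∏ j ∈ Finset.range m, (2 * (m + ν) - j))
        * ∫ t in Ioo (-1 : ℝ) 1, (1 - t ^ 2) ^ (m + ν)) * h1
  · intro t ht
    simp only [eval_rodriguesPoly_mul ν m ht, ← hp]
    ring

/-- Read backwards, the product is `Γ(2m + 2ν + 1) / Γ(m + 2ν + 1)`; Legendre's duplication formula
splits the numerator. -/
lemma prod_range_two_mul_sub {ν : ℝ} (hν : 0 < ν) (m : ℕ) :
    ∏ j ∈ Finset.range m, (2 * (m + ν) - j)
      = 4 ^ (m + ν) / √Real.pi * (Real.Gamma (m + (ν + 1 / 2)) * Real.Gamma (m + (ν + 1)))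
        / Real.Gamma (m + (2 * ν + 1)) := by
  have h1 : ∏ j ∈ Finset.range m, (2 * (m + ν) - j)
      = ∏ j ∈ Finset.range m, (m + (2 * ν + 1) + j) := by
    rw [← Finset.prod_range_reflect]
    refine Finset.prod_congr rfl fun j hj => ?_
    have := Finset.mem_range.1 hj
    rw [Nat.sub_sub, Nat.cast_sub (by omega)]
    push_cast
    ring
  have hm : (0 : ℝ) ≤ m := m.cast_nonneg
  have h2 := Gamma_natCast_add (b := m + (2 * ν + 1)) (by linarith) m
  have h3 := Real.Gamma_mul_Gamma_add_half (m + (ν + 1 / 2))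
  have h4 : Real.Gamma (m + (2 * ν + 1)) ≠ 0 := (Real.Gamma_pos_of_pos (by linarith)).ne'
  have h5 : (2 : ℝ) ^ (1 - 2 * (m + (ν + 1 / 2))) * 4 ^ (m + ν) = 1 := by
    rw [show (4 : ℝ) = 2 ^ (2 : ℝ) by norm_num, ← Real.rpow_mul zero_le_two,
      ← Real.rpow_add two_pos]
    ring_nf
    simp
  rw [show (m + (ν + 1 / 2) + 1 / 2 : ℝ) = m + (ν + 1) by ring,
    show 2 * (m + (ν + 1 / 2)) = (m + (m + (2 * ν + 1)) : ℝ) by ring, h2] at h3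
  rw [show (1 - (m + (m + (2 * ν + 1))) : ℝ) = 1 - 2 * (m + (ν + 1 / 2)) by ring] at h3
  have h6 : √Real.pi ≠ 0 := (Real.sqrt_pos.2 Real.pi_pos).ne'
  rw [h1, h3]
  generalize ∏ j ∈ Finset.range m, (m + (2 * ν + 1) + j : ℝ) = p
  generalize (4 : ℝ) ^ (m + ν) = u at *
  generalize (2 : ℝ) ^ (1 - 2 * (m + (ν + 1 / 2))) = v at *
  have h7 : u / √Real.pi * (Real.Gamma (m + (2 * ν + 1)) * p * v * √Real.pi)
      / Real.Gamma (m + (2 * ν + 1)) = p * (v * u) := by field_simp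
  rw [h7, h5, mul_one]

lemma integral_one_sub_sq_rpow_le {s : ℝ} (hs : 0 ≤ s) :
    ∫ t in Ioo (-1 : ℝ) 1, (1 - t ^ 2) ^ s ≤ 2 := by
  calc ∫ t in Ioo (-1 : ℝ) 1, (1 - t ^ 2) ^ s ≤ ∫ t in Ioo (-1 : ℝ) 1, (1 : ℝ) := by
        refine setIntegral_mono_on (integrableOn_one_sub_sq_rpow (by linarith))
          (by simp) measurableSet_Ioo fun t ht =>
          Real.rpow_le_one (one_sub_sq_pos ht).le (by nlinarith) hs
    _ = 2 := by simp; norm_num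

/-- The squared weighted norm of the normalised polynomials, with shifted parameter. -/
lemma isBigO_rodriguesFactor_sq_mul_integral {μ : ℝ} {K : ℕ} (hμ : -1 < μ) (hK : 1 ≤ K) :
    (fun m : ℕ => rodriguesFactor μ (m + K) ^ 2 * ∫ t in Ioo (-1 : ℝ) 1,
        (rodriguesPoly (m + (μ + K)) m).eval t ^ 2 * (1 - t ^ 2) ^ (μ + K))
      =O[atTop] fun m : ℕ => (m : ℝ) ^ (-(2 * (μ + K))) := by
  have hK' : (1 : ℝ) ≤ K := by exact_mod_cast hK
  set ν := μ + K with hν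
  have hν0 : 0 < ν := by linarith
  set c := Real.Gamma (μ + 1) ^ 2 * 4 ^ μ / √Real.pi
  -- The powers of `m` in this Gamma quotient add up to `-(2 * ν + 1 / 2)`; the leftover `1 / m !`
  -- cancels the `m !` of the squared norm.
  have hlim := (((tendsto_Gamma_div (b := ν + 1 / 2) (by linarith)).div
    ((tendsto_Gamma_div (b := ν + 1) (by linarith)).mul
      (tendsto_Gamma_div (b := 2 * ν + 1) (by linarith))) (by norm_num)).const_mul c)
  have hO := hlim.isBigO_one ℝ
  simp only [Pi.div_apply] at hO
  -- A crude estimate: the integral is bounded by `2` and half a power of `m` is given away. As `K`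
  -- is free, the loss is harmless.
  have h1 : (fun m : ℕ => (m : ℝ) ^ (-(2 * ν + 1 / 2)) * ∫ t in Ioo (-1 : ℝ) 1,
      (1 - t ^ 2) ^ (m + ν)) =O[atTop] fun m : ℕ => (m : ℝ) ^ (-(2 * ν)) := by
    refine Asymptotics.IsBigO.of_bound 2 ?_
    filter_upwards [eventually_ge_atTop 1] with m hm
    have hm' : (1 : ℝ) ≤ m := by exact_mod_cast hm
    have h0 : 0 ≤ ∫ t in Ioo (-1 : ℝ) 1, (1 - t ^ 2) ^ (m + ν) :=
      setIntegral_nonneg measurableSet_Ioo fun t ht =>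
        (Real.rpow_pos_of_pos (one_sub_sq_pos ht) _).le
    rw [norm_mul, Real.norm_of_nonneg h0, Real.norm_of_nonneg (by positivity),
      Real.norm_of_nonneg (by positivity), mul_comm]
    exact mul_le_mul (integral_one_sub_sq_rpow_le (by linarith))
      (Real.rpow_le_rpow_of_exponent_le hm' (by linarith)) (by positivity) (by norm_num)
  refine ((hO.mul h1).congr' ?_ ?_)
  · filter_upwards [eventually_ge_atTop 1] with m hm
    have hm0 : (0 : ℝ) < m := by exact_mod_cast hm
    rw [integral_rodriguesPoly_sq (by linarith), prod_range_two_mul_sub hν0, rodriguesFactor]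
    push_cast
    rw [show (m + K + μ + 1 : ℝ) = m + (ν + 1) by rw [hν]; ring]
    have e1 : (4 : ℝ) ^ (m + ν) = (2 ^ (m + K)) ^ 2 * 4 ^ μ := by
      rw [hν, show (m + (μ + K) : ℝ) = ((m + K : ℕ) : ℝ) + μ by push_cast; ring,
        Real.rpow_add (by norm_num), Real.rpow_natCast, ← pow_mul, mul_comm (m + K) 2, pow_mul]
      norm_num
    have e2 : (m : ℝ) ^ (-(2 * ν + 1 / 2)) * ((m : ℝ) ^ (ν + 1 - 1) * (m : ℝ) ^ (2 * ν + 1 - 1))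
        = (m : ℝ) ^ (ν + 1 / 2 - 1) := by
      rw [← Real.rpow_add hm0, ← Real.rpow_add hm0]
      ring_nf
    have e3 : (((-1 : ℝ) ^ (m + K)) ^ 2) = 1 := by rw [← pow_mul, mul_comm, pow_mul]; simp
    simp only [e1, div_pow, mul_pow, e3, ← e2]
    have g1 : Real.Gamma (m + (ν + 1)) ≠ 0 := (Real.Gamma_pos_of_pos (by linarith)).ne'
    have g2 : Real.Gamma (m + (2 * ν + 1)) ≠ 0 := (Real.Gamma_pos_of_pos (by linarith)).ne'
    have g3 : √Real.pi ≠ 0 := (Real.sqrt_pos.2 Real.pi_pos).ne'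
    have g4 : (m.factorial : ℝ) ≠ 0 := by positivity
    have g5 := (Real.rpow_pos_of_pos hm0 (-(2 * ν + 1 / 2))).ne'
    have g6 := (Real.rpow_pos_of_pos hm0 (ν + 1 - 1)).ne'
    have g7 := (Real.rpow_pos_of_pos hm0 (2 * ν + 1 - 1)).ne'
    clear e2
    generalize (m : ℝ) ^ (-(2 * ν + 1 / 2)) = u at *
    generalize (m : ℝ) ^ (ν + 1 - 1) = v at *
    generalize (m : ℝ) ^ (2 * ν + 1 - 1) = w at *
    simp only [c]
    field_simp
  · exact Eventually.of_forall fun m => by simp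

lemma integrableOn_eval_mul_one_sub_sq_rpow {ν : ℝ} (hν : -1 < ν) (p : ℝ[X]) :
    IntegrableOn (fun t => p.eval t * (1 - t ^ 2) ^ ν) (Ioo (-1) 1) := by
  have h := (derivBounded_eval p 0).endpointBounded.integrableOn (a := ν) (k := 0) (m := 0) le_rfl
    (by push_cast; linarith)
  simpa only [iteratedDeriv_zero] using h

/-- The inequality `2 * |y| ≤ ε * y ^ 2 + ε⁻¹` with `y = x * p`. It plays the role of
Cauchy–Schwarz, with `ε` to be optimised after integration. -/
lemma abs_mul_mul_le {M x g p ε : ℝ} (hg : |g| ≤ M) (hε : 0 < ε) :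
    |x * (g * p)| ≤ M / 2 * (ε * (x ^ 2 * p ^ 2) + ε⁻¹) := by
  have h1 : 2 * |x * p| ≤ ε * (x * p) ^ 2 + ε⁻¹ := by
    have h2 : 0 ≤ ε⁻¹ * (ε * |x * p| - 1) ^ 2 := by positivity
    have h3 : ε⁻¹ * (ε * |x * p| - 1) ^ 2 = ε * |x * p| ^ 2 - 2 * |x * p| + ε⁻¹ := by
      field_simp
      ring
    rw [h3, sq_abs] at h2
    linarith
  calc |x * (g * p)| = |g| * |x * p| := by rw [← abs_mul]; ring_nf
    _ ≤ M * |x * p| := by gcongr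
    _ ≤ M * ((ε * (x * p) ^ 2 + ε⁻¹) / 2) := by
        have := (abs_nonneg g).trans hg
        gcongr
        linarith
    _ = _ := by ring

/-- Moving only `K` of the `m + K` derivatives leaves the degree-`m` Rodrigues polynomial for the
weight exponent `μ + K`; `abs_mul_mul_le` is then integrated against that weight. -/
lemma DerivBounded.abs_rodriguesIntegral_le {μ M ε : ℝ} {K : ℕ} {g : ℝ → ℝ}
    (hg : DerivBounded K g) (hμ : -1 < μ)
    (hM : ∀ t ∈ Ioo (-1 : ℝ) 1, |iteratedDeriv K g t| ≤ M) (hε : 0 < ε) (m : ℕ) :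
    |rodriguesIntegral μ g (m + K)| ≤ M / 2 *
      (ε * (rodriguesFactor μ (m + K) ^ 2 * ∫ t in Ioo (-1 : ℝ) 1,
        (rodriguesPoly (m + (μ + K)) m).eval t ^ 2 * (1 - t ^ 2) ^ (μ + K))
        + ε⁻¹ * ∫ t in Ioo (-1 : ℝ) 1, (1 - t ^ 2) ^ (μ + K)) := by
  have hK : (0 : ℝ) ≤ K := K.cast_nonneg
  set ρ := rodriguesFactor μ (m + K)
  set p := rodriguesPoly (m + (μ + K)) m
  have hcast : ((m + K : ℕ) + μ : ℝ) = m + (μ + K) := by push_cast; ring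
  have h := hg.endpointBounded.integral_mul_iteratedDeriv (a := m + (μ + K)) le_rfl m
    (by push_cast; linarith)
  have hp : IntegrableOn (fun t => p.eval t ^ 2 * (1 - t ^ 2) ^ (μ + K)) (Ioo (-1) 1) := by
    have := integrableOn_eval_mul_one_sub_sq_rpow (ν := μ + K) (by linarith) (p ^ 2)
    simp only [eval_pow] at this
    exact this
  have hw := integrableOn_one_sub_sq_rpow (s := μ + K) (by linarith)
  rw [rodriguesIntegral, hcast, h, mul_left_comm, abs_mul, abs_pow, abs_neg, abs_one, one_pow,
    one_mul, ← integral_const_mul, ← integral_const_mul, ← integral_const_mul,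
    ← integral_const_mul, ← integral_add ((hp.const_mul _).const_mul _) (hw.const_mul _),
    ← integral_const_mul, ← Real.norm_eq_abs]
  refine norm_integral_le_of_norm_le (g := fun t => M / 2 * (ε * (ρ ^ 2 * (p.eval t ^ 2
    * (1 - t ^ 2) ^ (μ + K))) + ε⁻¹ * (1 - t ^ 2) ^ (μ + K))) ((((hp.const_mul _).const_mul _).add
    (hw.const_mul _)).const_mul _) ((ae_restrict_iff' measurableSet_Ioo).2
    (Eventually.of_forall fun t ht => ?_))
  have hw0 : 0 ≤ (1 - t ^ 2) ^ (μ + K) := (Real.rpow_pos_of_pos (one_sub_sq_pos ht) _).le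
  rw [eval_rodriguesPoly_mul _ _ ht, ← mul_assoc, ← mul_assoc, norm_mul, Real.norm_of_nonneg hw0,
    Real.norm_eq_abs, mul_assoc]
  refine (mul_le_mul_of_nonneg_right (abs_mul_mul_le (p := p.eval t) (hM t ht) hε) hw0).trans_eq ?_
  ring

/-- The coefficients of a function with `K` bounded derivatives decay at least like
`n ^ (-(μ + K))`. -/
lemma DerivBounded.isBigO_rodriguesIntegral {μ : ℝ} {K : ℕ} {g : ℝ → ℝ}
    (hg : DerivBounded K g) (hμ : -1 < μ) (hK : 1 ≤ K) :
    rodriguesIntegral μ g =O[atTop] fun n : ℕ => (n : ℝ) ^ (-(μ + K)) := by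
  obtain ⟨M, hM⟩ := hg.bound K le_rfl
  have hK' : (1 : ℝ) ≤ K := by exact_mod_cast hK
  have hν : 0 < μ + K := by linarith
  obtain ⟨C, hC⟩ := (isBigO_rodriguesFactor_sq_mul_integral hμ hK).bound
  have hM0 : 0 ≤ M := (abs_nonneg _).trans (hM 0 (by norm_num))
  set J := ∫ t in Ioo (-1 : ℝ) 1, (1 - t ^ 2) ^ (μ + K)
  have h1 : (fun m : ℕ => rodriguesIntegral μ g (m + K)) =O[atTop]
      fun m : ℕ => (m : ℝ) ^ (-(μ + K)) := by
    refine Asymptotics.IsBigO.of_bound (M / 2 * (C + J)) ?_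
    filter_upwards [hC, eventually_gt_atTop 0] with m hm hm0
    have hm' : (0 : ℝ) < m := by exact_mod_cast hm0
    -- The choice `ε = m ^ (μ + K)` balances `ε * m ^ (-2 * (μ + K))` against `ε⁻¹`.
    have h2 := hg.abs_rodriguesIntegral_le hμ hM (Real.rpow_pos_of_pos hm' (μ + K)) m
    rw [Real.norm_eq_abs, Real.norm_of_nonneg (by positivity : 0 ≤ (m : ℝ) ^ (-(μ + K)))]
    rw [Real.norm_of_nonneg (by positivity : 0 ≤ (m : ℝ) ^ (-(2 * (μ + K))))] at hm
    refine h2.trans ?_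
    have h3 := (le_abs_self _).trans hm
    have h4 : (m : ℝ) ^ (μ + K) * (C * (m : ℝ) ^ (-(2 * (μ + K)))) = C * (m : ℝ) ^ (-(μ + K)) := by
      rw [mul_left_comm, ← Real.rpow_add hm']
      ring_nf
    calc _ ≤ M / 2 * ((m : ℝ) ^ (μ + K) * (C * (m : ℝ) ^ (-(2 * (μ + K))))
            + ((m : ℝ) ^ (μ + K))⁻¹ * J) := by gcongr
      _ = _ := by rw [h4, ← Real.rpow_neg hm'.le]; ring
  have h2 : rodriguesIntegral μ g =O[atTop] fun n : ℕ => ((n - K : ℕ) : ℝ) ^ (-(μ + K)) := by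
    refine (h1.comp_tendsto (tendsto_sub_atTop_nat K)).congr' ?_ EventuallyEq.rfl
    filter_upwards [eventually_ge_atTop K] with n hn
    simp [Nat.sub_add_cancel hn]
  -- The constant comes from `n ≤ (K + 1) * (n - K)` for `n > K`.
  refine h2.trans (Asymptotics.IsBigO.of_bound ((K + 1) ^ (μ + K)) ?_)
  filter_upwards [eventually_gt_atTop K] with n hn
  obtain ⟨m, rfl⟩ := Nat.exists_eq_add_of_lt hn
  rw [Real.norm_of_nonneg (by positivity), Real.norm_of_nonneg (by positivity),
    show K + m + 1 - K = m + 1 by omega, Real.rpow_neg (by positivity),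
    Real.rpow_neg (by positivity), ← div_eq_mul_inv, inv_le_comm₀ (by positivity) (by positivity),
    inv_div, div_le_iff₀ (by positivity), ← Real.mul_rpow (by positivity) (by positivity)]
  refine Real.rpow_le_rpow (by positivity) ?_ hν.le
  push_cast
  nlinarith [(Nat.cast_nonneg m : (0 : ℝ) ≤ m)]

/-! ### Absolute convergence and linearity -/

/-- Absolute convergence of all integrals `rodriguesIntegral μ g n`. -/
def RodriguesIntegrable (μ : ℝ) (g : ℝ → ℝ) : Prop :=
  ∀ n : ℕ, IntegrableOn
    (fun t => g t * iteratedDeriv n (fun s : ℝ => (1 - s ^ 2) ^ (n + μ)) t) (Ioo (-1) 1)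

lemma EndpointBounded.rodriguesIntegrable {μ σ : ℝ} {K : ℕ} {g : ℝ → ℝ}
    (hg : EndpointBounded σ K g) (h : -1 < σ + μ) : RodriguesIntegrable μ g := fun n => by
  simpa using hg.integrableOn (a := n + μ) (k := 0) (m := n) K.zero_le (by push_cast; linarith)

lemma min_zero_add {μ a : ℝ} (hμ : -1 < μ) (ha : -1 < a + μ) : -1 < min a 0 + μ := by
  rcases min_choice a 0 with h | h <;> rw [h] <;> linarith

lemma rodriguesIntegrable_one_add_rpow {μ a : ℝ} (hμ : -1 < μ) (ha : -1 < a + μ) :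
    RodriguesIntegrable μ (fun t => (1 + t) ^ a) :=
  (endpointBounded_one_add_rpow a 0).rodriguesIntegrable (min_zero_add hμ ha)

lemma rodriguesIntegrable_one_sub_rpow {μ a : ℝ} (hμ : -1 < μ) (ha : -1 < a + μ) :
    RodriguesIntegrable μ (fun t => (1 - t) ^ a) :=
  (endpointBounded_one_sub_rpow a 0).rodriguesIntegrable (min_zero_add hμ ha)

lemma RodriguesIntegrable.add {μ : ℝ} {g h : ℝ → ℝ} (hg : RodriguesIntegrable μ g)
    (hh : RodriguesIntegrable μ h) : RodriguesIntegrable μ (fun t => g t + h t) := fun n => by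
  simp only [add_mul]
  exact (hg n).add (hh n)

lemma RodriguesIntegrable.sum_const_mul {μ : ℝ} {s : Finset ℕ} (c : ℕ → ℝ) {g : ℕ → ℝ → ℝ}
    (hg : ∀ i ∈ s, RodriguesIntegrable μ (g i)) :
    RodriguesIntegrable μ (fun t => ∑ i ∈ s, c i * g i t) := fun n => by
  simp only [Finset.sum_mul, mul_assoc]
  exact integrable_finsetSum _ fun i hi => (hg i hi n).const_mul _

lemma rodriguesIntegral_add {μ : ℝ} {g h : ℝ → ℝ} (hg : RodriguesIntegrable μ g)
    (hh : RodriguesIntegrable μ h) (n : ℕ) :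
    rodriguesIntegral μ (fun t => g t + h t) n
      = rodriguesIntegral μ g n + rodriguesIntegral μ h n := by
  simp only [rodriguesIntegral, add_mul]
  rw [integral_add (hg n) (hh n), mul_add]

lemma rodriguesIntegral_sum_const_mul {μ : ℝ} {s : Finset ℕ} (c : ℕ → ℝ) {g : ℕ → ℝ → ℝ}
    (hg : ∀ i ∈ s, RodriguesIntegrable μ (g i)) (n : ℕ) :
    rodriguesIntegral μ (fun t => ∑ i ∈ s, c i * g i t) n
      = ∑ i ∈ s, c i * rodriguesIntegral μ (g i) n := by
  simp only [rodriguesIntegral, Finset.sum_mul, mul_assoc]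
  rw [integral_finsetSum _ fun i hi => (hg i hi n).const_mul _, Finset.mul_sum]
  refine Finset.sum_congr rfl fun i _ => ?_
  rw [integral_const_mul, mul_left_comm]

/-! ### The remainder after subtracting both expansions -/

lemma exists_bound_of_isBigO_one {F : ℝ → ℝ} (hF : ContinuousOn F (Ioo (-1) 1))
    (hl : F =O[𝓝[>] (-1)] fun _ => (1 : ℝ)) (hr : F =O[𝓝[<] 1] fun _ => (1 : ℝ)) :
    ∃ M, ∀ t ∈ Ioo (-1 : ℝ) 1, |F t| ≤ M := by
  obtain ⟨M₁, h₁⟩ := hl.bound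
  obtain ⟨M₂, h₂⟩ := hr.bound
  obtain ⟨a, ha, ha'⟩ := (mem_nhdsGT_iff_exists_Ioo_subset' (by norm_num : (-1 : ℝ) < 0)).1 h₁
  obtain ⟨b, hb, hb'⟩ := (mem_nhdsLT_iff_exists_Ioo_subset' (by norm_num : (0 : ℝ) < 1)).1 h₂
  have ha0 : (-1 : ℝ) < a := ha
  have hb0 : b < (1 : ℝ) := hb
  obtain ⟨M₃, h₃⟩ := isCompact_Icc.exists_bound_of_continuousOn (s := Icc a b)
    (hF.mono fun t ht => ⟨ha0.trans_le ht.1, ht.2.trans_lt hb0⟩)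
  refine ⟨max M₁ (max M₂ M₃), fun t ht => ?_⟩
  by_cases hta : t < a
  · have h : ‖F t‖ ≤ M₁ * ‖(1 : ℝ)‖ := ha' ⟨ht.1, hta⟩
    rw [norm_one, mul_one] at h
    exact h.trans (le_max_left _ _)
  by_cases htb : b < t
  · have h : ‖F t‖ ≤ M₂ * ‖(1 : ℝ)‖ := hb' ⟨htb, ht.2⟩
    rw [norm_one, mul_one] at h
    exact h.trans ((le_max_left _ _).trans (le_max_right _ _))
  · exact (h₃ t ⟨not_lt.1 hta, not_lt.1 htb⟩).trans ((le_max_right _ _).trans (le_max_right _ _))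

lemma contDiffOn_one_add_rpow (a : ℝ) :
    ContDiffOn ℝ ∞ (fun s : ℝ => (1 + s) ^ a) (Ioo (-1) 1) := (endpointBounded_one_add_rpow a 0).1

lemma contDiffOn_one_sub_rpow (a : ℝ) :
    ContDiffOn ℝ ∞ (fun s : ℝ => (1 - s) ^ a) (Ioo (-1) 1) := (endpointBounded_one_sub_rpow a 0).1

/-- `f` minus the first `m` terms of its expansions at both endpoints. -/
def endpointRemainder (f : ℝ → ℝ) (A α B β : ℕ → ℝ) (m : ℕ) (t : ℝ) : ℝ :=
  f t - ∑ i ∈ Finset.range m, A i * (1 + t) ^ α i - ∑ i ∈ Finset.range m, B i * (1 - t) ^ β i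

lemma contDiffOn_endpointRemainder {f : ℝ → ℝ} (hf : ContDiffOn ℝ ∞ f (Ioo (-1) 1))
    (A α B β : ℕ → ℝ) (m : ℕ) :
    ContDiffOn ℝ ∞ (endpointRemainder f A α B β m) (Ioo (-1) 1) :=
  (hf.sub (ContDiffOn.sum fun i _ => contDiffOn_const.mul (contDiffOn_one_add_rpow (α i)))).sub
    (ContDiffOn.sum fun i _ => contDiffOn_const.mul (contDiffOn_one_sub_rpow (β i)))

lemma iteratedDeriv_sum_const_mul {c : ℕ → ℝ} {g : ℕ → ℝ → ℝ}
    (hg : ∀ i, ContDiffOn ℝ ∞ (g i) (Ioo (-1) 1)) (m k : ℕ) {t : ℝ} (ht : t ∈ Ioo (-1 : ℝ) 1) :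
    iteratedDeriv k (fun s => ∑ i ∈ Finset.range m, c i * g i s) t
      = ∑ i ∈ Finset.range m, c i * iteratedDeriv k (g i) t := by
  have h : ∀ i, ContDiffAt ℝ k (g i) t := fun i =>
    (contDiffAt_of_smooth (hg i) ht).of_le (mod_cast le_top)
  rw [iteratedDeriv_fun_sum fun i _ => contDiffAt_const.mul (h i)]
  exact Finset.sum_congr rfl fun i _ => iteratedDeriv_const_mul_field _ _

lemma iteratedDeriv_endpointRemainder {f : ℝ → ℝ} (hf : ContDiffOn ℝ ∞ f (Ioo (-1) 1))
    (A α B β : ℕ → ℝ) (m k : ℕ) {t : ℝ} (ht : t ∈ Ioo (-1 : ℝ) 1) :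
    iteratedDeriv k (endpointRemainder f A α B β m) t = iteratedDeriv k f t
      - ∑ i ∈ Finset.range m, A i * iteratedDeriv k (fun s : ℝ => (1 + s) ^ α i) t
      - ∑ i ∈ Finset.range m, B i * iteratedDeriv k (fun s : ℝ => (1 - s) ^ β i) t := by
  have h1 : ContDiffAt ℝ k f t := (contDiffAt_of_smooth hf ht).of_le (mod_cast le_top)
  have h2 : ContDiffAt ℝ k (fun s => ∑ i ∈ Finset.range m, A i * (1 + s) ^ α i) t :=
    ContDiffAt.sum fun i _ => contDiffAt_const.mul
      ((contDiffAt_of_smooth (contDiffOn_one_add_rpow (α i)) ht).of_le (mod_cast le_top))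
  have h3 : ContDiffAt ℝ k (fun s => ∑ i ∈ Finset.range m, B i * (1 - s) ^ β i) t :=
    ContDiffAt.sum fun i _ => contDiffAt_const.mul
      ((contDiffAt_of_smooth (contDiffOn_one_sub_rpow (β i)) ht).of_le (mod_cast le_top))
  have h12 : ContDiffAt ℝ k (f - fun s => ∑ i ∈ Finset.range m, A i * (1 + s) ^ α i) t := h1.sub h2
  rw [← iteratedDeriv_sum_const_mul (fun i => contDiffOn_one_add_rpow (α i)) m k ht,
    ← iteratedDeriv_sum_const_mul (fun i => contDiffOn_one_sub_rpow (β i)) m k ht,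
    ← iteratedDeriv_sub h1 h2, ← iteratedDeriv_sub h12 h3]
  rfl

lemma isBigO_one_rpow_of_tendsto {l : Filter ℝ} {u : ℝ → ℝ} {c s : ℝ} (hu : Tendsto u l (𝓝 c))
    (hs : 0 ≤ s ∨ c ≠ 0) : (fun t => u t ^ s) =O[l] fun _ => (1 : ℝ) :=
  (hu.rpow_const hs.symm).isBigO_one ℝ

/-- Near `-1` the left expansion leaves `O((1 + t) ^ (α (m + 1) - k))` with nonnegative exponent,
while the subtracted powers of `1 - t` are smooth there; near `1` the roles are exchanged. -/
lemma derivBounded_endpointRemainder {d : ℕ} {f : ℝ → ℝ} {A α B β : ℕ → ℝ}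
    (hf : HasEndpointExpansions d f A α B β) {K m : ℕ} (hα : K ≤ α (m + 1))
    (hβ : K ≤ β (m + 1)) : DerivBounded K (endpointRemainder f A α B β (m + 1)) := by
  have hs := contDiffOn_endpointRemainder hf.smooth A α B β (m + 1)
  refine ⟨hs, fun k hk => exists_bound_of_isBigO_one (continuousOn_iteratedDeriv hs k) ?_ ?_⟩
  · have hk' : (k : ℝ) ≤ K := by exact_mod_cast hk
    have hp : Tendsto (fun t : ℝ => 1 + t) (𝓝[>] (-1)) (𝓝 0) := by
      have : Tendsto (fun t : ℝ => 1 + t) (𝓝 (-1)) (𝓝 (1 + -1)) :=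
        Continuous.tendsto (by fun_prop) _
      rw [add_neg_cancel] at this
      exact this.mono_left nhdsWithin_le_nhds
    have hq : Tendsto (fun t : ℝ => 1 - t) (𝓝[>] (-1)) (𝓝 2) := by
      have : Tendsto (fun t : ℝ => 1 - t) (𝓝 (-1)) (𝓝 (1 - -1)) :=
        Continuous.tendsto (by fun_prop) _
      rw [show (1 - -1 : ℝ) = 2 by norm_num] at this
      exact this.mono_left nhdsWithin_le_nhds
    refine (((hf.left k m).trans (isBigO_one_rpow_of_tendsto hp (Or.inl (by linarith)))).sub
      (Asymptotics.IsBigO.sum (s := Finset.range (m + 1))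
        (A := fun i t => B i * iteratedDeriv k (fun s : ℝ => (1 - s) ^ β i) t)
        fun i _ => ?_)).congr' ?_ EventuallyEq.rfl
    · simp only [iteratedDeriv_one_sub_rpow]
      exact (((isBigO_one_rpow_of_tendsto hq (Or.inr two_ne_zero)).const_mul_left _).const_mul_left
        _).const_mul_left _
    · filter_upwards [Ioo_mem_nhdsGT (by norm_num : (-1 : ℝ) < 1)] with t ht
      rw [iteratedDeriv_endpointRemainder hf.smooth A α B β _ _ ht, Finset.sum_apply]
  · have hk' : (k : ℝ) ≤ K := by exact_mod_cast hk
    have hp : Tendsto (fun t : ℝ => 1 - t) (𝓝[<] 1) (𝓝 0) := by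
      have : Tendsto (fun t : ℝ => 1 - t) (𝓝 1) (𝓝 (1 - 1)) := Continuous.tendsto (by fun_prop) _
      rw [sub_self] at this
      exact this.mono_left nhdsWithin_le_nhds
    have hq : Tendsto (fun t : ℝ => 1 + t) (𝓝[<] 1) (𝓝 2) := by
      have : Tendsto (fun t : ℝ => 1 + t) (𝓝 1) (𝓝 (1 + 1)) := Continuous.tendsto (by fun_prop) _
      rw [one_add_one_eq_two] at this
      exact this.mono_left nhdsWithin_le_nhds
    refine (((hf.right k m).trans (isBigO_one_rpow_of_tendsto hp (Or.inl (by linarith)))).sub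
      (Asymptotics.IsBigO.sum (s := Finset.range (m + 1))
        (A := fun i t => A i * iteratedDeriv k (fun s : ℝ => (1 + s) ^ α i) t)
        fun i _ => ?_)).congr' ?_ EventuallyEq.rfl
    · simp only [iteratedDeriv_one_add_rpow]
      exact ((isBigO_one_rpow_of_tendsto hq (Or.inr two_ne_zero)).const_mul_left _).const_mul_left _
    · filter_upwards [Ioo_mem_nhdsLT (by norm_num : (-1 : ℝ) < 1)] with t ht
      rw [iteratedDeriv_endpointRemainder hf.smooth A α B β _ _ ht, Finset.sum_apply]
      ring

lemma exists_derivBounded_endpointRemainder {d : ℕ} {f : ℝ → ℝ} {A α B β : ℕ → ℝ}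
    (hf : HasEndpointExpansions d f A α B β) (K : ℕ) :
    ∃ m₀, ∀ m ≥ m₀, DerivBounded K (endpointRemainder f A α B β m) := by
  obtain ⟨m₀, h⟩ := eventually_atTop.1 ((hf.left_admissible.tendsto.eventually_ge_atTop (K : ℝ)).and
    (hf.right_admissible.tendsto.eventually_ge_atTop (K : ℝ)))
  refine ⟨m₀ + 1, fun m hm => ?_⟩
  obtain ⟨m, rfl⟩ := Nat.exists_eq_add_of_lt (Nat.lt_of_succ_le hm)
  exact derivBounded_endpointRemainder hf (h _ (by omega)).1 (h _ (by omega)).2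

/-- The bound `(1 - d) / 2` on the exponents is exactly integrability of the powers against the
weight. -/
lemma IsAdmissible.lt_add {d : ℕ} {A α : ℕ → ℝ} (h : IsAdmissible d A α) (i : ℕ) :
    -1 < α i + ((d : ℝ) - 3) / 2 := by
  have h1 := h.lower
  have h2 := h.strictMono.monotone i.zero_le
  linarith

lemma eq_add_endpointRemainder (f : ℝ → ℝ) (A α B β : ℕ → ℝ) (m : ℕ) :
    f = fun t => (endpointRemainder f A α B β m t + ∑ i ∈ Finset.range m, A i * (1 + t) ^ α i)
      + ∑ i ∈ Finset.range m, B i * (1 - t) ^ β i := by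
  ext t
  rw [endpointRemainder]
  ring

lemma neg_one_lt_of_two_le {d : ℕ} (hd : 2 ≤ d) : (-1 : ℝ) < ((d : ℝ) - 3) / 2 := by
  have : (2 : ℝ) ≤ d := by exact_mod_cast hd
  linarith

lemma HasEndpointExpansions.rodriguesIntegrable {d : ℕ} (hd : 2 ≤ d) {f : ℝ → ℝ}
    {A α B β : ℕ → ℝ} (hf : HasEndpointExpansions d f A α B β) :
    RodriguesIntegrable (((d : ℝ) - 3) / 2) f := by
  have hμ := neg_one_lt_of_two_le hd
  obtain ⟨m, hm⟩ := exists_derivBounded_endpointRemainder hf 0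
  rw [eq_add_endpointRemainder f A α B β m]
  exact (((hm m le_rfl).endpointBounded.rodriguesIntegrable (by linarith)).add
    (RodriguesIntegrable.sum_const_mul A fun i _ => rodriguesIntegrable_one_add_rpow hμ
      (hf.left_admissible.lt_add i))).add (RodriguesIntegrable.sum_const_mul B fun i _ =>
        rodriguesIntegrable_one_sub_rpow hμ (hf.right_admissible.lt_add i))

lemma HasEndpointExpansions.rodriguesIntegral_eq {d : ℕ} (hd : 2 ≤ d) {f : ℝ → ℝ}
    {A α B β : ℕ → ℝ} (hf : HasEndpointExpansions d f A α B β) {m : ℕ}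
    (hm : DerivBounded 0 (endpointRemainder f A α B β m)) (n : ℕ) :
    rodriguesIntegral (((d : ℝ) - 3) / 2) f n
      = rodriguesIntegral (((d : ℝ) - 3) / 2) (endpointRemainder f A α B β m) n
        + (-1) ^ n * ∑ i ∈ Finset.range m, A i * endpointMoment (((d : ℝ) - 3) / 2) (α i) n
        + ∑ i ∈ Finset.range m, B i * endpointMoment (((d : ℝ) - 3) / 2) (β i) n := by
  have hμ := neg_one_lt_of_two_le hd
  set μ := ((d : ℝ) - 3) / 2
  have hr : RodriguesIntegrable μ (endpointRemainder f A α B β m) :=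
    hm.endpointBounded.rodriguesIntegrable (by linarith)
  have hA : ∀ i ∈ Finset.range m, RodriguesIntegrable μ fun t => (1 + t) ^ α i := fun i _ =>
    rodriguesIntegrable_one_add_rpow hμ (hf.left_admissible.lt_add i)
  have hB : ∀ i ∈ Finset.range m, RodriguesIntegrable μ fun t => (1 - t) ^ β i := fun i _ =>
    rodriguesIntegrable_one_sub_rpow hμ (hf.right_admissible.lt_add i)
  conv_lhs => rw [eq_add_endpointRemainder f A α B β m]
  rw [rodriguesIntegral_add (hr.add (.sum_const_mul A hA)) (.sum_const_mul B hB),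
    rodriguesIntegral_add hr (.sum_const_mul A hA), rodriguesIntegral_sum_const_mul A hA,
    rodriguesIntegral_sum_const_mul B hB, Finset.mul_sum]
  congr 2
  · refine Finset.sum_congr rfl fun i _ => ?_
    rw [rodriguesIntegral_one_add_rpow hμ (hf.left_admissible.lt_add i), mul_left_comm]
  · refine funext fun i => ?_
    rw [rodriguesIntegral_one_sub_rpow hμ (hf.right_admissible.lt_add i)]

/-! ### The prefactor and the passage to Legendre coefficients -/

lemma sphereArea_pos {k : ℕ} (hk : 1 ≤ k) : 0 < sphereArea k := by
  have : Nonempty (Fin k) := ⟨⟨0, hk⟩⟩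
  rw [sphereArea, Measure.toSphere_real_apply_univ, finrank_euclideanSpace_fin]
  have h : 0 < (volume : Measure (EuclideanSpace ℝ (Fin k))).real (Metric.ball 0 1) :=
    ENNReal.toReal_pos (Metric.measure_ball_pos _ _ one_pos).ne' measure_ball_lt_top.ne
  have : (0 : ℝ) < k := by exact_mod_cast hk
  positivity

lemma tendsto_harmonicDim_div {d : ℕ} (hd : 2 ≤ d) :
    Tendsto (fun n : ℕ => harmonicDim d n / (n : ℝ) ^ (d - 2)) atTop
      (𝓝 (2 / (d - 2).factorial)) := by
  obtain ⟨e, rfl⟩ := Nat.exists_eq_add_of_le' hd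
  rw [Nat.add_sub_cancel]
  have h1 : Tendsto (fun n : ℕ => ((n.choose e : ℕ) : ℝ) / (n : ℝ) ^ e) atTop
      (𝓝 (1 / e.factorial)) := by
    have h := (Asymptotics.isEquivalent_iff_tendsto_one (by
      filter_upwards [eventually_gt_atTop 0] with n hn
      positivity)).1 (isEquivalent_choose e)
    refine (h.div_const (e.factorial : ℝ)).congr' ?_
    filter_upwards [eventually_gt_atTop 0] with n hn
    simp only [Pi.div_apply]
    field_simp
  have h2 : Tendsto (fun n : ℕ => n + e - 1) atTop atTop :=
    tendsto_atTop_mono (fun n => by omega) (tendsto_sub_atTop_nat 1)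
  have h3 : Tendsto (fun n : ℕ => (n : ℝ)⁻¹) atTop (𝓝 0) := tendsto_inv_atTop_nhds_zero_nat
  have h4 := ((h3.mul_const (e : ℝ)).const_add 2).mul ((h1.comp h2).mul
    (((h3.mul_const (e - 1 : ℝ)).const_add 1).pow e))
  simp only [zero_mul, add_zero, one_pow, mul_one, mul_one_div] at h4
  refine h4.congr' ?_
  filter_upwards [eventually_gt_atTop 0] with n hn
  have hn0 : (n : ℝ) ≠ 0 := by positivity
  have h5 : ((n + e - 1 : ℕ) : ℝ) = n + e - 1 := by
    rw [Nat.cast_sub (by omega)]; push_cast; ring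
  rw [harmonicDim, if_neg hn.ne', show n + (e + 2) - 3 = n + e - 1 by omega,
    ← Nat.choose_symm_of_eq_add (show n + e - 1 = e + (n - 1) by omega), Function.comp_apply, h5]
  have h6 : (1 + (n : ℝ)⁻¹ * (e - 1)) = (n + e - 1) / n := by field_simp; ring
  have h7 : (2 + (n : ℝ)⁻¹ * e) = (2 * n + e) / n := by field_simp
  rw [h6, h7, div_pow]
  push_cast
  -- For `e = 0` the base `n + e - 1` is zero at `n = 1` and cannot be cancelled, but its exponent
  -- is then `0`.
  rcases eq_or_ne e 0 with rfl | he
  · simp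
  · have h8 : (n + e - 1 : ℝ) ≠ 0 := by
      rw [← h5]
      exact_mod_cast (by omega : n + e - 1 ≠ 0)
    field_simp
    ring

lemma legendreCoeff_integrand_eq (d : ℕ) (f : ℝ → ℝ) (n : ℕ) {t : ℝ}
    (ht : t ∈ Ioo (-1 : ℝ) 1) :
    f t * legendreP d n t * weight d t = rodriguesFactor (((d : ℝ) - 3) / 2) n
      * (f t * iteratedDeriv n (fun s : ℝ => (1 - s ^ 2) ^ (n + ((d : ℝ) - 3) / 2)) t) := by
  have h1 : (1 - t ^ 2) ^ (-(((d : ℝ) - 3) / 2)) * (1 - t ^ 2) ^ (((d : ℝ) - 3) / 2) = 1 := by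
    rw [← Real.rpow_add (one_sub_sq_pos ht), neg_add_cancel, Real.rpow_zero]
  rw [legendreP, weight, rodriguesFactor, show ((d : ℝ) - 3) / 2 + 1 = ((d : ℝ) - 1) / 2 by ring,
    show (n + ((d : ℝ) - 3) / 2 + 1 : ℝ) = n + ((d : ℝ) - 1) / 2 by ring]
  linear_combination ((-1) ^ n / 2 ^ n * (Real.Gamma (((d : ℝ) - 1) / 2)
    / Real.Gamma (n + ((d : ℝ) - 1) / 2)) * (f t * iteratedDeriv n
      (fun s : ℝ => (1 - s ^ 2) ^ (n + ((d : ℝ) - 3) / 2)) t)) * h1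

lemma legendreCoeff_eq (d : ℕ) (f : ℝ → ℝ) (n : ℕ) :
    legendreCoeff d f n = harmonicDim d n * sphereArea (d - 1) / sphereArea d
      * rodriguesIntegral (((d : ℝ) - 3) / 2) f n := by
  rw [legendreCoeff, setIntegral_congr_fun measurableSet_Ioo
    fun t ht => legendreCoeff_integrand_eq d f n ht, integral_const_mul, rodriguesIntegral]

lemma HasEndpointExpansions.integrableOn {d : ℕ} (hd : 2 ≤ d) {f : ℝ → ℝ} {A α B β : ℕ → ℝ}
    (hf : HasEndpointExpansions d f A α B β) (n : ℕ) :
    IntegrableOn (fun t => f t * legendreP d n t * weight d t) (Ioo (-1) 1) :=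
  IntegrableOn.congr_fun (Integrable.const_mul (hf.rodriguesIntegrable hd n) _)
    (fun _ ht => (legendreCoeff_integrand_eq d f n ht).symm) measurableSet_Ioo

/-! ### Leading asymptotics -/

lemma tendsto_natCast_rpow_zero {s : ℝ} (hs : s < 0) :
    Tendsto (fun n : ℕ => (n : ℝ) ^ s) atTop (𝓝 0) := by
  have h := (tendsto_rpow_neg_atTop (neg_pos.2 hs)).comp (tendsto_natCast_atTop_atTop (R := ℝ))
  rw [neg_neg] at h
  exact h

/-- No singular exponent of the expansion lies below `γ`. -/
def NoSingularBelow (A α : ℕ → ℝ) (γ : ℝ) : Prop :=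
  ∀ i, A i ≠ 0 → (∀ m : ℕ, α i ≠ m) → γ ≤ α i

lemma endpointConst_natCast (μ : ℝ) (m : ℕ) : endpointConst μ m = 0 := by
  rw [endpointConst, (Real.Gamma_eq_zero_iff _).2 ⟨m, rfl⟩, inv_zero, mul_zero]

/-- Exponents other than `γ` drop out: a natural one has eventually zero moments, a larger one
decays faster. A natural `γ` is allowed, and then the limit is `0`. -/
lemma tendsto_coeff_mul_endpointMoment {μ γ c a : ℝ} (hμ : -1 < μ) (ha : -1 < a + μ)
    (h : c ≠ 0 → (∀ m : ℕ, a ≠ m) → γ ≤ a) :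
    Tendsto (fun n : ℕ => c * endpointMoment μ a n * (n : ℝ) ^ (2 * (γ + μ + 1))) atTop
      (𝓝 ((if a = γ then c else 0) * endpointConst μ γ)) := by
  rcases eq_or_ne a γ with rfl | hne
  · simp only [if_true, mul_assoc]
    exact (tendsto_endpointMoment hμ ha).const_mul c
  rw [if_neg hne, zero_mul]
  rcases eq_or_ne c 0 with rfl | hc
  · simp
  by_cases hm : ∃ m : ℕ, a = m
  · obtain ⟨m, rfl⟩ := hm
    refine tendsto_const_nhds.congr' ?_
    filter_upwards [eventually_gt_atTop m] with n hn
    rw [endpointMoment_natCast hn, mul_zero, zero_mul]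
  · push Not at hm
    have hlt : γ < a := lt_of_le_of_ne (h hc hm) hne.symm
    have h1 := ((tendsto_endpointMoment hμ ha).const_mul c).mul
      (tendsto_natCast_rpow_zero (s := 2 * (γ - a)) (by linarith))
    rw [mul_zero] at h1
    refine h1.congr' ?_
    filter_upwards [eventually_gt_atTop 0] with n hn
    have hn0 : (0 : ℝ) < n := by exact_mod_cast hn
    rw [show 2 * (γ + μ + 1) = 2 * (a + μ + 1) + 2 * (γ - a) by ring, Real.rpow_add hn0]
    ring

lemma tendsto_sum_endpointMoment {μ γ : ℝ} (hμ : -1 < μ) {A α : ℕ → ℝ}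
    (hα : ∀ i, -1 < α i + μ) (h : NoSingularBelow A α γ) (m : ℕ) :
    Tendsto (fun n : ℕ => (∑ i ∈ Finset.range m, A i * endpointMoment μ (α i) n)
        * (n : ℝ) ^ (2 * (γ + μ + 1))) atTop
      (𝓝 ((∑ i ∈ Finset.range m, if α i = γ then A i else 0) * endpointConst μ γ)) := by
  simp only [Finset.sum_mul]
  exact tendsto_finsetSum _ fun i _ => tendsto_coeff_mul_endpointMoment hμ (hα i) (h i)

/-- `a` is the coefficient of the exponent `γ` (zero if the exponent does not occur). -/
def IsCoeffAt (A α : ℕ → ℝ) (γ a : ℝ) : Prop :=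
  ∀ᶠ m in atTop, ∑ i ∈ Finset.range m, (if α i = γ then A i else 0) = a

lemma isCoeffAt_zero {A α : ℕ → ℝ} {γ : ℝ} (h : ∀ i, α i = γ → A i = 0) :
    IsCoeffAt A α γ 0 :=
  Eventually.of_forall fun _ => Finset.sum_eq_zero fun i _ => by
    split_ifs with hi
    exacts [h i hi, rfl]

lemma isCoeffAt_apply (A : ℕ → ℝ) {α : ℕ → ℝ} (hα : StrictMono α) (j : ℕ) :
    IsCoeffAt A α (α j) (A j) := by
  filter_upwards [eventually_gt_atTop j] with m hm
  rw [Finset.sum_eq_single_of_mem j (Finset.mem_range.2 hm), if_pos rfl]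
  intro i _ hi
  rw [if_neg fun h => hi (hα.injective h)]

lemma exists_isCoeffAt (A : ℕ → ℝ) {α : ℕ → ℝ} (hα : StrictMono α) (γ : ℝ) :
    ∃ a, IsCoeffAt A α γ a := by
  by_cases h : ∃ j, α j = γ
  · obtain ⟨j, rfl⟩ := h
    exact ⟨_, isCoeffAt_apply A hα j⟩
  · push Not at h
    exact ⟨0, isCoeffAt_zero fun i hi => absurd hi (h i)⟩

/-- Stated as a difference tending to zero, since `(-1) ^ n * a + b` generally oscillates. -/
lemma HasEndpointExpansions.tendsto_rodriguesIntegral {d : ℕ} (hd : 2 ≤ d) {f : ℝ → ℝ}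
    {A α B β : ℕ → ℝ} (hf : HasEndpointExpansions d f A α B β) {γ a b : ℝ}
    (hα : NoSingularBelow A α γ) (hβ : NoSingularBelow B β γ)
    (ha : IsCoeffAt A α γ a) (hb : IsCoeffAt B β γ b) :
    Tendsto (fun n : ℕ => rodriguesIntegral (((d : ℝ) - 3) / 2) f n
        * (n : ℝ) ^ (2 * (γ + ((d : ℝ) - 3) / 2 + 1))
        - ((-1) ^ n * a + b) * endpointConst (((d : ℝ) - 3) / 2) γ) atTop (𝓝 0) := by
  have hμ := neg_one_lt_of_two_le hd
  set μ := ((d : ℝ) - 3) / 2 with hμd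
  set s := 2 * (γ + μ + 1)
  -- With `μ + K > s` the remainder is `o(n ^ (-s))`.
  obtain ⟨K, hK⟩ := exists_nat_gt (max 1 (s - μ))
  have hK1 : 1 ≤ K := by exact_mod_cast ((le_max_left _ _).trans_lt hK).le
  have hKs : s - μ < K := (le_max_right _ _).trans_lt hK
  obtain ⟨m₀, hm₀⟩ := exists_derivBounded_endpointRemainder hf K
  obtain ⟨m, hm, hma, hmb⟩ := ((eventually_ge_atTop m₀).and (ha.and hb)).exists
  have hr := hm₀ m hm
  have hr0 : DerivBounded 0 (endpointRemainder f A α B β m) :=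
    ⟨hr.smooth, fun k hk => hr.bound k (hk.trans K.zero_le)⟩
  have h1 : Tendsto (fun n : ℕ => rodriguesIntegral μ (endpointRemainder f A α B β m) n
      * (n : ℝ) ^ s) atTop (𝓝 0) := by
    have h := (hr.isBigO_rodriguesIntegral hμ hK1).mul
      (Asymptotics.isBigO_refl (fun n : ℕ => (n : ℝ) ^ s) atTop)
    refine h.trans_tendsto ((tendsto_natCast_rpow_zero (s := -(μ + K) + s)
      (by linarith)).congr' ?_)
    filter_upwards [eventually_gt_atTop 0] with n hn
    rw [Real.rpow_add (by exact_mod_cast hn)]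
  have h2 := tendsto_sum_endpointMoment hμ hf.left_admissible.lt_add hα m
  have h3 := tendsto_sum_endpointMoment hμ hf.right_admissible.lt_add hβ m
  rw [hma] at h2
  rw [hmb] at h3
  have h4 : Tendsto (fun n : ℕ => (-1 : ℝ) ^ n * ((∑ i ∈ Finset.range m,
      A i * endpointMoment μ (α i) n) * (n : ℝ) ^ s - a * endpointConst μ γ)) atTop (𝓝 0) := by
    refine squeeze_zero_norm (fun n => ?_) (tendsto_zero_iff_norm_tendsto_zero.1
      (tendsto_sub_nhds_zero_iff.2 h2))
    simp [s]
  have h5 := (h1.add h4).add (tendsto_sub_nhds_zero_iff.2 h3)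
  rw [add_zero, add_zero] at h5
  refine h5.congr fun n => ?_
  rw [hf.rodriguesIntegral_eq hd hr0 n]
  ring

/-- The constant in the asymptotics of the Legendre coefficients. -/
def legendreConst (d : ℕ) (γ : ℝ) : ℝ :=
  2 / (d - 2).factorial * (sphereArea (d - 1) / sphereArea d)
    * endpointConst (((d : ℝ) - 3) / 2) γ

lemma legendreConst_natCast (d m : ℕ) : legendreConst d m = 0 := by
  rw [legendreConst, endpointConst_natCast, mul_zero]

lemma legendreConst_ne_zero {d : ℕ} (hd : 2 ≤ d) {γ : ℝ} (hγ : -1 < γ + ((d : ℝ) - 3) / 2)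
    (h : ∀ m : ℕ, γ ≠ m) : legendreConst d γ ≠ 0 := by
  have h1 := endpointConst_ne_zero (neg_one_lt_of_two_le hd) hγ h
  have h2 := (sphereArea_pos (k := d) (by omega))
  have h3 := (sphereArea_pos (k := d - 1) (by omega))
  rw [legendreConst]
  positivity

/-- The leading behaviour of the Legendre coefficients for every `γ` below which there is no
singular exponent. -/
theorem HasEndpointExpansions.tendsto_legendreCoeff {d : ℕ} (hd : 2 ≤ d) {f : ℝ → ℝ}
    {A α B β : ℕ → ℝ} (hf : HasEndpointExpansions d f A α B β) {γ a b : ℝ}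
    (hα : NoSingularBelow A α γ) (hβ : NoSingularBelow B β γ)
    (ha : IsCoeffAt A α γ a) (hb : IsCoeffAt B β γ b) :
    Tendsto (fun n : ℕ => legendreCoeff d f n * (n : ℝ) ^ (2 * γ + 1)
        - ((-1) ^ n * a + b) * legendreConst d γ) atTop (𝓝 0) := by
  have h1 := hf.tendsto_rodriguesIntegral hd hα hβ ha hb
  set κ := endpointConst (((d : ℝ) - 3) / 2) γ
  set S := sphereArea (d - 1) / sphereArea d with hS
  have h2 := (tendsto_harmonicDim_div hd).mul_const S
  have h3 := tendsto_sub_nhds_zero_iff.2 h2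
  -- The main term is only bounded, so replacing the prefactor by its limit is a separate error:
  -- null sequence times bounded sequence.
  have h4 : Tendsto (fun n : ℕ => (harmonicDim d n / (n : ℝ) ^ (d - 2) * S
      - 2 / (d - 2).factorial * S) * (((-1) ^ n * a + b) * κ)) atTop (𝓝 0) := by
    refine h3.zero_mul_isBoundedUnder_le (isBoundedUnder_of ⟨(|a| + |b|) * |κ|, fun n => ?_⟩)
    rw [Function.comp_apply, norm_mul, Real.norm_eq_abs κ]
    gcongr
    refine (norm_add_le _ _).trans ?_
    simp
  have h5 := (h2.mul h1).add h4
  rw [mul_zero, add_zero] at h5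
  refine h5.congr' ?_
  filter_upwards [eventually_gt_atTop 0] with n hn
  have hn0 : (0 : ℝ) < n := by exact_mod_cast hn
  -- The growth `n ^ (d - 2)` of `harmonicDim` absorbs the dimension from the exponent.
  have e1 : (n : ℝ) ^ (2 * (γ + ((d : ℝ) - 3) / 2 + 1))
      = (n : ℝ) ^ (2 * γ + 1) * (n : ℝ) ^ (d - 2) := by
    rw [← Real.rpow_natCast, ← Real.rpow_add hn0, Nat.cast_sub hd]
    push_cast
    ring_nf
  have e2 : (n : ℝ) ^ (d - 2) ≠ 0 := by positivity
  rw [legendreCoeff_eq, e1, legendreConst, mul_div_assoc, ← hS]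
  field_simp
  ring

/-! ### Singular exponents and rapid decay -/

lemma exists_singularExponent_eq {d : ℕ} {A α : ℕ → ℝ} (h : IsAdmissible d A α)
    (hs : singularExponent A α ≠ ⊤) :
    ∃ j, A j ≠ 0 ∧ (∀ m : ℕ, α j ≠ m) ∧ singularExponent A α = (α j : EReal) := by
  classical
  have hex : ∃ j, A j ≠ 0 ∧ ∀ m : ℕ, α j ≠ m := by
    by_contra! hno
    refine hs (sInf_eq_top.2 ?_)
    rintro x ⟨i, hi, hAi, rfl⟩
    obtain ⟨m, hm⟩ := hno i hAi
    exact absurd hm (hi m)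
  obtain ⟨hA, hm⟩ := Nat.find_spec hex
  refine ⟨Nat.find hex, hA, hm, IsLeast.csInf_eq ⟨⟨_, hm, hA, rfl⟩, ?_⟩⟩
  rintro x ⟨i, hi, hAi, rfl⟩
  exact EReal.coe_le_coe_iff.2 (h.strictMono.monotone (Nat.find_min' hex ⟨hAi, hi⟩))

lemma noSingularBelow_of_le {A α : ℕ → ℝ} {γ : ℝ} (h : (γ : EReal) ≤ singularExponent A α) :
    NoSingularBelow A α γ := fun i hA hm =>
  EReal.coe_le_coe_iff.1 (h.trans (sInf_le ⟨i, hm, hA, rfl⟩))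

lemma isCoeffAt_zero_of_lt {A α : ℕ → ℝ} {γ : ℝ} (hγ : ∀ m : ℕ, γ ≠ m)
    (h : (γ : EReal) < singularExponent A α) : IsCoeffAt A α γ 0 := by
  refine isCoeffAt_zero fun i hi => ?_
  by_contra hA
  subst hi
  exact not_le.2 h (sInf_le ⟨i, hγ, hA, rfl⟩)

/-- Without singular exponents any `γ` is admissible in `tendsto_legendreCoeff`. Taking `γ = k`
natural makes the constant vanish, so even `n ^ (2 * k + 1)` times the coefficient tends to zero. -/
lemma superpolynomialDecay_legendreCoeff {d : ℕ} (hd : 2 ≤ d) {f : ℝ → ℝ} {A α B β : ℕ → ℝ}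
    (hf : HasEndpointExpansions d f A α B β) (hα : singularExponent A α = ⊤)
    (hβ : singularExponent B β = ⊤) :
    Asymptotics.SuperpolynomialDecay atTop (fun n : ℕ => (n : ℝ)) (legendreCoeff d f) := by
  intro k
  obtain ⟨a, ha⟩ := exists_isCoeffAt A hf.left_admissible.strictMono k
  obtain ⟨b, hb⟩ := exists_isCoeffAt B hf.right_admissible.strictMono k
  have h := hf.tendsto_legendreCoeff hd (noSingularBelow_of_le (by rw [hα]; exact le_top))
    (noSingularBelow_of_le (by rw [hβ]; exact le_top)) ha hb
  simp only [legendreConst_natCast, mul_zero, sub_zero] at h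
  refine squeeze_zero_norm' ?_ (tendsto_zero_iff_norm_tendsto_zero.1 h)
  filter_upwards [eventually_ge_atTop 1] with n hn
  have hn1 : (1 : ℝ) ≤ n := by exact_mod_cast hn
  rw [norm_mul, norm_mul, mul_comm, Real.norm_of_nonneg (by positivity : 0 ≤ (n : ℝ) ^ k),
    Real.norm_of_nonneg (by positivity : 0 ≤ (n : ℝ) ^ (2 * (k : ℝ) + 1)), ← Real.rpow_natCast]
  gcongr
  linarith [(Nat.cast_nonneg k : (0 : ℝ) ≤ k)]

/-! ### From limits to asymptotic equivalence along subsequences -/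

lemma natCast_rpow_mul_rpow {n : ℕ} (hn : 0 < n) (γ : ℝ) :
    (n : ℝ) ^ (2 * γ + 1) * (n : ℝ) ^ (-2 * γ - 1) = 1 := by
  rw [← Real.rpow_add (by exact_mod_cast hn), show 2 * γ + 1 + (-2 * γ - 1) = 0 by ring,
    Real.rpow_zero]

/-- Only the values `a + b` and `-a + b` occur, so the nonzero ones stay away from zero. If one of
them is zero, its inverse is `0` and adds nothing to `M`. -/
lemma exists_one_le_mul_abs (a b : ℝ) :
    ∃ M, ∀ n : ℕ, (-1) ^ n * a + b ≠ 0 → 1 ≤ M * |(-1) ^ n * a + b| := by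
  refine ⟨|a + b|⁻¹ + |-a + b|⁻¹, fun n hn => ?_⟩
  rw [add_mul]
  rcases neg_one_pow_eq_or ℝ n with h | h <;> rw [h] at hn ⊢
  · rw [one_mul] at hn ⊢
    rw [inv_mul_cancel₀ (abs_ne_zero.2 hn)]
    exact le_add_of_nonneg_right (by positivity)
  · rw [neg_one_mul] at hn ⊢
    rw [inv_mul_cancel₀ (abs_ne_zero.2 hn)]
    exact le_add_of_nonneg_left (by positivity)

lemma isLittleO_of_tendsto_of_eq_zero {u : ℕ → ℝ} {γ a b C : ℝ}
    (h : Tendsto (fun n : ℕ => u n * (n : ℝ) ^ (2 * γ + 1) - ((-1) ^ n * a + b) * C)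
      atTop (𝓝 0)) {φ : ℕ → ℕ} (hφ : Tendsto φ atTop atTop)
    (h0 : ∀ k, (-1) ^ φ k * a + b = 0) :
    (fun k : ℕ => |u (φ k)|) =o[atTop] fun k : ℕ => (φ k : ℝ) ^ (-2 * γ - 1) := by
  have h1 := (h.comp hφ).abs
  simp only [Function.comp_def, h0, zero_mul, sub_zero, abs_zero] at h1
  have h2 := ((Asymptotics.isLittleO_one_iff ℝ).2 h1).mul_isBigO
    (Asymptotics.isBigO_refl (fun k : ℕ => (φ k : ℝ) ^ (-2 * γ - 1)) atTop)
  simp only [one_mul] at h2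
  refine h2.congr' ?_ EventuallyEq.rfl
  filter_upwards [hφ.eventually_gt_atTop 0] with k hk
  rw [abs_mul, mul_assoc, abs_of_nonneg (by positivity : 0 ≤ (φ k : ℝ) ^ (2 * γ + 1)),
    natCast_rpow_mul_rpow hk, mul_one]

lemma isEquivalent_of_tendsto_of_ne_zero {u : ℕ → ℝ} {γ a b C : ℝ} (hC : C ≠ 0)
    (h : Tendsto (fun n : ℕ => u n * (n : ℝ) ^ (2 * γ + 1) - ((-1) ^ n * a + b) * C)
      atTop (𝓝 0)) {φ : ℕ → ℕ} (hφ : Tendsto φ atTop atTop)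
    (h0 : ∀ k, (-1) ^ φ k * a + b ≠ 0) :
    (fun k : ℕ => |u (φ k)|) ~[atTop]
      fun k : ℕ => |C| * |(-1) ^ φ k * a + b| * (φ k : ℝ) ^ (-2 * γ - 1) := by
  obtain ⟨M, hM⟩ := exists_one_le_mul_abs a b
  have h1 : Tendsto (fun k => |u (φ k) * (φ k : ℝ) ^ (2 * γ + 1)|
      - |C| * |(-1) ^ φ k * a + b|) atTop (𝓝 0) := by
    refine squeeze_zero_norm (fun k => ?_) (tendsto_zero_iff_norm_tendsto_zero.1 (h.comp hφ))
    rw [← abs_mul, mul_comm C]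
    exact abs_abs_sub_abs_le_abs_sub _ _
  have h2 : (fun _ : ℕ => (1 : ℝ)) =O[atTop] fun k => |C| * |(-1) ^ φ k * a + b| := by
    refine Asymptotics.IsBigO.of_bound (|C|⁻¹ * M) (Eventually.of_forall fun k => ?_)
    rw [norm_one, norm_mul, Real.norm_eq_abs, Real.norm_eq_abs, abs_abs, abs_abs]
    have := abs_ne_zero.2 hC
    field_simp
    exact hM _ (h0 k)
  have h3 := (((Asymptotics.isLittleO_one_iff ℝ).2 h1).trans_isBigO h2).mul_isBigO
    (Asymptotics.isBigO_refl (fun k : ℕ => (φ k : ℝ) ^ (-2 * γ - 1)) atTop)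
  refine Asymptotics.IsLittleO.congr' h3 ?_ EventuallyEq.rfl
  filter_upwards [hφ.eventually_gt_atTop 0] with k hk
  rw [sub_mul, abs_mul, mul_assoc, abs_of_nonneg (by positivity : 0 ≤ (φ k : ℝ) ^ (2 * γ + 1)),
    natCast_rpow_mul_rpow hk, mul_one, Pi.sub_apply]

/-- For the case where one endpoint dominates: one of `a`, `b` is then zero and the absolute value
removes the parity. -/
lemma isEquivalent_legendreCoeff_of_lt {d : ℕ} {f : ℝ → ℝ} {a b γ c : ℝ}
    (hC : legendreConst d γ ≠ 0) (hc : c ≠ 0)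
    (hab : ∀ n : ℕ, |(-1) ^ n * a + b| = |c|)
    (h : Tendsto (fun n : ℕ => legendreCoeff d f n * (n : ℝ) ^ (2 * γ + 1)
        - ((-1) ^ n * a + b) * legendreConst d γ) atTop (𝓝 0)) :
    ∃ c : ℝ, 0 < c ∧ (fun n : ℕ => |legendreCoeff d f n|) ~[atTop]
      fun n : ℕ => c * (n : ℝ) ^ (-2 * γ - 1) := by
  refine ⟨|legendreConst d γ| * |c|, by positivity, ?_⟩
  have h1 := isEquivalent_of_tendsto_of_ne_zero hC h tendsto_id fun n => by
    rw [← abs_ne_zero, id, hab]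
    exact abs_ne_zero.2 hc
  simpa only [id, hab] using h1

end GenLegendre

end

/-! ### The main theorem -/

theorem mainTheorem2 (d : ℕ) (hd : 2 ≤ d) (f : ℝ → ℝ) (A α B β : ℕ → ℝ)
    (hf : GenLegendre.HasEndpointExpansions d f A α B β) :
    -- the integrals that define the coefficients converge absolutely
    (∀ n : ℕ, MeasureTheory.IntegrableOn
      (fun t => f t * GenLegendre.legendreP d n t * GenLegendre.weight d t)
      (Set.Ioo (-1 : ℝ) 1)) ∧
    -- (i)
    (min (GenLegendre.singularExponent A α) (GenLegendre.singularExponent B β) = ⊤ →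
      Asymptotics.SuperpolynomialDecay Filter.atTop (fun n : ℕ => (n : ℝ))
        (GenLegendre.legendreCoeff d f)) ∧
    -- (ii)
    (GenLegendre.singularExponent A α ≠ GenLegendre.singularExponent B β →
      ∃ γ : ℝ,
        (γ : EReal) = min (GenLegendre.singularExponent A α) (GenLegendre.singularExponent B β) ∧
        ∃ c : ℝ, 0 < c ∧
          (fun n : ℕ => |GenLegendre.legendreCoeff d f n|) ~[Filter.atTop]
            fun n : ℕ => c * (n : ℝ) ^ (-2 * γ - 1)) ∧
    -- (iii)
    (GenLegendre.singularExponent A α = GenLegendre.singularExponent B β →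
      GenLegendre.singularExponent A α ≠ ⊤ →
      ∃ (γ : ℝ) (jα jβ : ℕ),
        (γ : EReal) = GenLegendre.singularExponent A α ∧ α jα = γ ∧ β jβ = γ ∧
        (∀ φ : ℕ → ℕ, StrictMono φ → (∀ k, (-1) ^ φ k * A jα + B jβ = 0) →
          (fun k : ℕ => |GenLegendre.legendreCoeff d f (φ k)|) =o[Filter.atTop]
            fun k : ℕ => (φ k : ℝ) ^ (-2 * γ - 1)) ∧
        ∃ c : ℝ, 0 < c ∧
          ∀ φ : ℕ → ℕ, StrictMono φ → (∀ k, (-1) ^ φ k * A jα + B jβ ≠ 0) →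
            (fun k : ℕ => |GenLegendre.legendreCoeff d f (φ k)|) ~[Filter.atTop]
              fun k : ℕ => c * |(-1) ^ φ k * A jα + B jβ| * (φ k : ℝ) ^ (-2 * γ - 1)) := by
  refine ⟨fun n => hf.integrableOn hd n, fun h => ?_, fun hne => ?_, fun heq htop => ?_⟩
  · obtain ⟨hα, hβ⟩ := min_eq_top.1 h
    exact GenLegendre.superpolynomialDecay_legendreCoeff hd hf hα hβ
  · rcases lt_or_gt_of_ne hne with hlt | hlt
    · obtain ⟨j, hA, hm, hj⟩ := GenLegendre.exists_singularExponent_eq hf.left_admissible hlt.ne_top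
      rw [hj] at hlt
      refine ⟨α j, by rw [hj, min_eq_left hlt.le], GenLegendre.isEquivalent_legendreCoeff_of_lt
        (GenLegendre.legendreConst_ne_zero hd (hf.left_admissible.lt_add j) hm) hA (fun n => ?_)
        (hf.tendsto_legendreCoeff hd (GenLegendre.noSingularBelow_of_le hj.ge)
          (GenLegendre.noSingularBelow_of_le hlt.le)
          (GenLegendre.isCoeffAt_apply A hf.left_admissible.strictMono j)
          (GenLegendre.isCoeffAt_zero_of_lt hm hlt))⟩
      simp [abs_mul]
    · obtain ⟨j, hB, hm, hj⟩ :=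
        GenLegendre.exists_singularExponent_eq hf.right_admissible hlt.ne_top
      rw [hj] at hlt
      refine ⟨β j, by rw [hj, min_eq_right hlt.le], GenLegendre.isEquivalent_legendreCoeff_of_lt
        (GenLegendre.legendreConst_ne_zero hd (hf.right_admissible.lt_add j) hm) hB (fun n => ?_)
        (hf.tendsto_legendreCoeff hd (GenLegendre.noSingularBelow_of_le hlt.le)
          (GenLegendre.noSingularBelow_of_le hj.ge)
          (GenLegendre.isCoeffAt_zero_of_lt hm hlt)
          (GenLegendre.isCoeffAt_apply B hf.right_admissible.strictMono j))⟩
      simp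
  · obtain ⟨i, -, hm, hi⟩ := GenLegendre.exists_singularExponent_eq hf.left_admissible htop
    obtain ⟨j, -, -, hj⟩ := GenLegendre.exists_singularExponent_eq hf.right_admissible (heq ▸ htop)
    have hij : β j = α i := EReal.coe_eq_coe_iff.1 (by rw [← hj, ← hi, heq])
    have hC := GenLegendre.legendreConst_ne_zero hd (hf.left_admissible.lt_add i) hm
    have h := hf.tendsto_legendreCoeff hd (GenLegendre.noSingularBelow_of_le hi.ge)
      (GenLegendre.noSingularBelow_of_le (heq ▸ hi.ge))
      (GenLegendre.isCoeffAt_apply A hf.left_admissible.strictMono i)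
      (hij ▸ GenLegendre.isCoeffAt_apply B hf.right_admissible.strictMono j)
    exact ⟨α i, i, j, hi.symm, rfl, hij,
      fun φ hφ h0 => GenLegendre.isLittleO_of_tendsto_of_eq_zero h hφ.tendsto_atTop h0,
      |GenLegendre.legendreConst d (α i)|, abs_pos.2 hC,
      fun φ hφ h0 => GenLegendre.isEquivalent_of_tendsto_of_ne_zero hC h hφ.tendsto_atTop h0⟩
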